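/- Let $\rho^1<\rho^2<\rho^3$ be real numbers. Let $T>0$, $C_\infty\in\mathbb R$, and let $f,g:\mathbb R^2\times[0,T]\to\mathbb R$ be functions with $f>g$ that are $C^1$ in $x\in\mathbb R^2$ and satisfy $f(x,t)\to C_\infty$ and $g(x,t)\to 0$ as $|x|\to\infty$ for every $t$ (so that $C_\infty\ge 0$), and suppose that $(f,g)$ solves the contour system $$f_t(x,t)=\frac{\rho^2-\rho^1}{4\pi}\,PV\!\!\int_{\mathbb R^2}\frac{(\nabla f(x,t)-\nabla f(x-y,t))\cdot y}{[|y|^2+(f(x,t)-f(x-y,t))^2]^{3/2}}dy+\frac{\rho^3-\rho^2}{4\pi}\,PV\!\!\int_{\mathbb R^2}\frac{(\nabla f(x,t)-\nabla g(x-y,t))\cdot y}{[|y|^2+(f(x,t)-g(x-y,t))^2]^{3/2}}dy,$$ $$g_t(x,t)=\frac{\rho^3-\rho^2}{4\pi}\,PV\!\!\int_{\mathbb R^2}\frac{(\nabla g(x,t)-\nabla g(x-y,t))\cdot y}{[|y|^2+(g(x,t)-g(x-y,t))^2]^{3/2}}dy+\frac{\rho^2-\rho^1}{4\pi}\,PV\!\!\int_{\mathbb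 R^2}\frac{(\nabla g(x,t)-\nabla f(x-y,t))\cdot y}{[|y|^2+(g(x,t)-f(x-y,t))^2]^{3/2}}dy$$ at every $(x,t)$, where $PV\int=\lim_{\varepsilon\to0,\,R\to\infty}\int_{\varepsilon<|y|<R}$. Let $\rho(\cdot,t)$ be the density on $\mathbb R^3$ equal to $\rho^1$ where $x_3>f(x_1,x_2,t)$, to $\rho^2$ where $f(x_1,x_2,t)>x_3>g(x_1,x_2,t)$, and to $\rho^3$ where $x_3<g(x_1,x_2,t)$, and let $u$ be the velocity given by Darcy's law $u=-\nabla p-(0,0,\rho)$, $\nabla\cdot u=0$, that is, $$u(\bar x,t)=PV\!\!\int_{\mathbb R^3}K(\bar x-\bar y)\,\rho(\bar y,t)\,d\bar y-\tfrac23(0,0,\rho(\bar x,t)),\qquad K(z)=-\frac1{4\pi|z|^5}\big(3z_1z_3,\;3z_2z_3,\;2z_3^2-z_1^2-z_2^2\big),$$ where $PV\int$ is the limit, as $\varepsilon\to0$ and $H\to\infty$, of the integrals over $\{\bar y:|\bar x-\bar y|>\varepsilon,\ |x_3-y_3|<H\}$ (so that a horizontally stratified fluid is at rest). Then there is a constant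 $C=C(\rho^1,\rho^2,\rho^3)>0$, depending on nothing else, such that for every such solution, every $t\in[0,T]$ and every $0<\gamma<1$, the principal value defining $u(\bar x,t)$ converges at every $\bar x$ off the two graphs, and $$\|u\|_{L^\infty(\mathbb R^3)}\le C\Big(1+\frac1\gamma+\frac1\gamma\ln\big(1+\|\nabla f\|_{C^\gamma}+\|\nabla g\|_{C^\gamma}\big)+\ln\big(1+\|f-C_\infty\|_{L^\infty}+C_\infty+\|\nabla f\|_{L^2}+\|g\|_{L^\infty}+\|\nabla g\|_{L^2}\big)\Big),$$ all norms being taken at time $t$, with $\|F\|_{C^\gamma}=\sup_x|F(x)|+\sup_{x\ne y}|F(x)-F(y)|/|x-y|^\gamma$. (If a norm on the right is infinite, so is the right-hand side.) -/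

import Mathlib

open MeasureTheory Filter Topology
open scoped NNReal ENNReal

noncomputable section

namespace Muskat

/-- The horizontal plane with its Euclidean norm. -/
abbrev R2 := EuclideanSpace ℝ (Fin 2)

/-- Three-dimensional space with its Euclidean norm; the coordinate `2` is the vertical one. -/
abbrev R3 := EuclideanSpace ℝ (Fin 3)

/-- The horizontal part `(x₁, x₂)` of a point `(x₁, x₂, x₃)`. -/
def horiz (x : R3) : R2 := !₂[x 0, x 1]

/-- The vertical unit vector. -/
def e3 : R3 := !₂[0, 0, 1]

/-! ### Density and Darcy velocity -/

/-- The three-phase density: `ρ₁` above the graph of `f`, `ρ₂` between the graphs of `g` and `f`,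
`ρ₃` below the graph of `g`. (The values on the two graphs, a null set, play no role.) -/
def density (ρ₁ ρ₂ ρ₃ : ℝ) (f g : R2 → ℝ) (x : R3) : ℝ :=
  if f (horiz x) < x 2 then ρ₁ else if g (horiz x) < x 2 then ρ₂ else ρ₃

/-- The kernel of `(∂₁ Δ⁻¹ ∂₃, ∂₂ Δ⁻¹ ∂₃, -∂₁ Δ⁻¹ ∂₁ - ∂₂ Δ⁻¹ ∂₂)` away from the origin, where
`Δ⁻¹` is convolution with `-1 / (4 π |x|)`; its Fourier symbol is
`(ξ₁ ξ₃, ξ₂ ξ₃, -(ξ₁² + ξ₂²)) / |ξ|²`. -/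
def darcyKernel (z : R3) : R3 :=
  (-(1 / (4 * Real.pi * ‖z‖ ^ 5))) •
    !₂[3 * z 0 * z 2, 3 * z 1 * z 2, 2 * z 2 ^ 2 - z 0 ^ 2 - z 1 ^ 2]

/-- The singular integral that expresses the velocity through the density, truncated to
`|x - y| > ε` and `|x₃ - y₃| < H`, together with its local term `-(2/3) (0, 0, ρ(x))`. -/
def darcyTrunc (ρ : R3 → ℝ) (x : R3) (ε H : ℝ) : R3 :=
  (∫ y in {y : R3 | ε < ‖x - y‖ ∧ |x 2 - y 2| < H}, ρ y • darcyKernel (x - y))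
    - ((2 / 3) * ρ x) • e3

/-- The Darcy velocity of a density:
`u(x) = PV ∫ K(x - y) ρ(y) dy - (2/3) (0, 0, ρ(x))`.
The principal value removes balls around `x` and, as the density does not decay vertically,
exhausts space by horizontal slabs; so a horizontally stratified density is at rest. -/
def darcyVelocity (ρ : R3 → ℝ) (x : R3) : R3 :=
  limUnder (𝓝[>] (0 : ℝ) ×ˢ atTop) (fun q : ℝ × ℝ => darcyTrunc ρ x q.1 q.2)

/-! ### The contour system -/

/-- `A` is the principal value of `∫ φ(y) dy` over the plane, at the origin and at infinity. -/
def IsPV (φ : R2 → ℝ) (A : ℝ) : Prop :=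
  Tendsto (fun q : ℝ × ℝ => ∫ y in {y : R2 | q.1 < ‖y‖ ∧ ‖y‖ < q.2}, φ y)
    (𝓝[>] (0 : ℝ) ×ˢ atTop) (𝓝 A)

/-- The integrand
`(∇f(x) - ∇g(x - y)) · y / [|y|² + (f(x) - g(x - y))²]^{3/2}` of the contour system. -/
def contourIntegrand (f g : R2 → ℝ) (x y : R2) : ℝ :=
  inner ℝ (gradient f x - gradient g (x - y)) y /
    (‖y‖ ^ 2 + (f x - g (x - y)) ^ 2) ^ (3 / 2 : ℝ)

/-- Classical solutions `(f, g)` on the time interval `[0, T]` of the contour system, the first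
argument being time: continuously differentiable graphs with `f > g`, where `f` tends to `Cinf` and
`g` to `0` at infinity, that satisfy the two evolution equations at every point. -/
structure IsContourSolution (ρ₁ ρ₂ ρ₃ Cinf T : ℝ) (f g : ℝ → R2 → ℝ) : Prop where
  contDiff_f : ∀ t ∈ Set.Icc 0 T, ContDiff ℝ 1 (f t)
  contDiff_g : ∀ t ∈ Set.Icc 0 T, ContDiff ℝ 1 (g t)
  lt : ∀ t ∈ Set.Icc 0 T, ∀ x, g t x < f t x
  tendsto_f : ∀ t ∈ Set.Icc 0 T, Tendsto (f t) (cocompact R2) (𝓝 Cinf)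
  tendsto_g : ∀ t ∈ Set.Icc 0 T, Tendsto (g t) (cocompact R2) (𝓝 0)
  eq_f : ∀ t ∈ Set.Icc 0 T, ∀ x, ∃ A B : ℝ,
    IsPV (contourIntegrand (f t) (f t) x) A ∧ IsPV (contourIntegrand (f t) (g t) x) B ∧
    HasDerivWithinAt (fun s => f s x)
      ((ρ₂ - ρ₁) / (4 * Real.pi) * A + (ρ₃ - ρ₂) / (4 * Real.pi) * B) (Set.Icc 0 T) t
  eq_g : ∀ t ∈ Set.Icc 0 T, ∀ x, ∃ A B : ℝ,
    IsPV (contourIntegrand (g t) (g t) x) A ∧ IsPV (contourIntegrand (g t) (f t) x) B ∧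
    HasDerivWithinAt (fun s => g s x)
      ((ρ₃ - ρ₂) / (4 * Real.pi) * A + (ρ₂ - ρ₁) / (4 * Real.pi) * B) (Set.Icc 0 T) t

/-- The (possibly infinite) norm of `C^γ`: supremum norm plus Hölder seminorm. -/
def cGammaNorm (γ : ℝ≥0) (F : R2 → R2) : ℝ≥0∞ :=
  (⨆ x, ‖F x‖ₑ) + eHolderNorm γ F

end Muskat

end

noncomputable section

namespace Muskat

/-! ### The kernel -/

/-! After the substitution z = x - y, the density is the constant ρ₁ plus a jump across each
interface, each jump being a multiple of the indicator `side s` of the region above a graph, where s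
is the `height` of x over the interface. So it suffices to treat one graph with s(0) ≠ 0.

The kernel K is even, homogeneous of degree -3 and of mean zero on spherical shells. Evenness
replaces `side s` by half of 1 + `asym s` (`setIntegral_side_smul`). The truncated integral of K
itself is one fixed vector (`setIntegral_slab`). The function `asym s` is constant on a ball about
the origin that misses the graph, where K averages to zero, and it vanishes at large heights because
s is bounded. So the truncated integrals are eventually constant, which gives convergence and leaves
an integral away from the origin to be estimated.

Over a horizontal point w, `asym s` is supported in a vertical interval of length |s(w) + s(-w)|.
Let A = |s(0)| and let M, N control the gradient in C^γ and the amplitude. The Hölder bound gives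
length at most 2A + 2M|w|^(1+γ), the amplitude bound 2A + 4N. Integrating K vertically costs at most
a multiple of |w|^(-2), or the length times |w|^(-3). The first cost is used where r < |w| ≤ A, with
r = A/(4(1+M)), and at middle distances; there it yields logarithms of ratios of radii. The second
is used where A < |w| ≤ (1+M)^(-1/γ) and far out; there it yields bounded terms and 1/γ. The
distance A from x to the interface cancels everywhere, so the bound is uniform in x
(`lintegral_asym_le`). -/

lemma norm_sq_eq (z : R3) : ‖z‖ ^ 2 = z 0 ^ 2 + z 1 ^ 2 + z 2 ^ 2 := by
  simp [EuclideanSpace.norm_sq_eq, Fin.sum_univ_three]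

lemma norm_horiz_sq (z : R3) : ‖horiz z‖ ^ 2 = z 0 ^ 2 + z 1 ^ 2 := by
  simp [EuclideanSpace.norm_sq_eq, Fin.sum_univ_two, horiz]

lemma norm_horiz_le (z : R3) : ‖horiz z‖ ≤ ‖z‖ := by
  have h1 := norm_sq_eq z
  have h2 := norm_horiz_sq z
  exact le_of_sq_le_sq (by nlinarith [sq_nonneg (z 2)]) (norm_nonneg _)

lemma abs_vert_le (z : R3) : |z 2| ≤ ‖z‖ := by
  simpa using PiLp.norm_apply_le z 2

lemma horiz_neg (z : R3) : horiz (-z) = -horiz z := by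
  ext i; fin_cases i <;> simp [horiz]

lemma horiz_sub (x z : R3) : horiz (x - z) = horiz x - horiz z := by
  ext i; fin_cases i <;> simp [horiz]

lemma continuous_horiz : Continuous horiz := by
  unfold horiz; fun_prop

lemma darcyKernel_neg (z : R3) : darcyKernel (-z) = darcyKernel z := by
  simp [darcyKernel]

lemma darcyKernel_smul {c : ℝ} (hc : 0 < c) (z : R3) :
    darcyKernel (c • z) = (c ^ 3)⁻¹ • darcyKernel z := by
  unfold darcyKernel
  rw [norm_smul, Real.norm_of_nonneg hc.le]
  rcases eq_or_ne z 0 with rfl | hz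
  · ext i; fin_cases i <;> simp
  have : ‖z‖ ≠ 0 := by simpa using hz
  ext i; fin_cases i <;> simp <;> field_simp

lemma norm_darcyKernel_le (z : R3) : ‖darcyKernel z‖ ≤ (‖z‖ ^ 3)⁻¹ := by
  rcases eq_or_ne z 0 with rfl | hz
  · simp [darcyKernel]
  have hz' : 0 < ‖z‖ := by simpa using hz
  have hpi := Real.pi_gt_three
  have key : ‖(!₂[3 * z 0 * z 2, 3 * z 1 * z 2, 2 * z 2 ^ 2 - z 0 ^ 2 - z 1 ^ 2] : R3)‖
      ≤ 2 * ‖z‖ ^ 2 := by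
    refine le_of_sq_le_sq ?_ (by positivity)
    rw [norm_sq_eq, mul_pow, norm_sq_eq]
    simp
    nlinarith [mul_nonneg (sq_nonneg (z 0)) (sq_nonneg (z 0)),
      mul_nonneg (sq_nonneg (z 0)) (sq_nonneg (z 1)),
      mul_nonneg (sq_nonneg (z 0)) (sq_nonneg (z 2)),
      mul_nonneg (sq_nonneg (z 1)) (sq_nonneg (z 1)),
      mul_nonneg (sq_nonneg (z 1)) (sq_nonneg (z 2))]
  unfold darcyKernel
  rw [norm_smul, norm_neg, Real.norm_of_nonneg (by positivity)]
  calc _ ≤ 1 / (4 * Real.pi * ‖z‖ ^ 5) * (2 * ‖z‖ ^ 2) := by gcongr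
    _ = (2 / (4 * Real.pi)) * (‖z‖ ^ 3)⁻¹ := by field_simp
    _ ≤ 1 * (‖z‖ ^ 3)⁻¹ := by
      gcongr
      rw [div_le_one (by positivity)]; linarith
    _ = _ := one_mul _

lemma measurable_darcyKernel : Measurable darcyKernel := by
  unfold darcyKernel
  have h : Measurable fun z : R3 => -(1 / (4 * Real.pi * ‖z‖ ^ 5)) := by fun_prop
  have h' : Continuous fun z : R3 =>
      (!₂[3 * z 0 * z 2, 3 * z 1 * z 2, 2 * z 2 ^ 2 - z 0 ^ 2 - z 1 ^ 2] : R3) := by fun_prop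
  exact h.smul h'.measurable

/-- The open-closed spherical shell. -/
def shell (a b : ℝ) : Set R3 := {z | a < ‖z‖ ∧ ‖z‖ ≤ b}

lemma measurableSet_shell (a b : ℝ) : MeasurableSet (shell a b) :=
  (measurableSet_lt measurable_const measurable_norm).inter
    (measurableSet_le measurable_norm measurable_const)

lemma integrableOn_shell {a : ℝ} (ha : 0 < a) (b : ℝ) :
    IntegrableOn darcyKernel (shell a b) := by
  have hfin : volume (shell a b) < ⊤ := by
    refine (measure_mono (t := Metric.closedBall 0 b) ?_).trans_lt measure_closedBall_lt_top
    intro z hz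
    simpa using hz.2
  refine Measure.integrableOn_of_bounded (M := (a ^ 3)⁻¹) hfin.ne
    measurable_darcyKernel.aestronglyMeasurable ?_
  refine (ae_restrict_mem (measurableSet_shell a b)).mono fun z hz => ?_
  refine (norm_darcyKernel_le z).trans ?_
  have := hz.1.le
  gcongr

lemma setIntegral_shell_comp (e : R3 ≃ₗᵢ[ℝ] R3) (a b : ℝ) (φ : R3 → ℝ) :
    ∫ z in shell a b, φ (e z) = ∫ z in shell a b, φ z := by
  have h := e.measurePreserving.setIntegral_preimage_emb
    e.toHomeomorph.measurableEmbedding φ (shell a b)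
  rw [← h]
  congr 2
  ext z
  simp [shell]

/-- Changing the sign of one coordinate. -/
def flip (i : Fin 3) : R3 ≃ₗᵢ[ℝ] R3 :=
  LinearIsometryEquiv.piLpCongrRight 2
    (fun j => if j = i then LinearIsometryEquiv.neg ℝ else LinearIsometryEquiv.refl ℝ ℝ)

/-- Permuting the coordinates. -/
def permute (σ : Equiv.Perm (Fin 3)) : R3 ≃ₗᵢ[ℝ] R3 :=
  LinearIsometryEquiv.piLpCongrLeft 2 ℝ ℝ σ

/-- The kernel has mean zero on spheres. -/
lemma setIntegral_shell {a : ℝ} (ha : 0 < a) (b : ℝ) :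
    ∫ z in shell a b, darcyKernel z = 0 := by
  have hi := integrableOn_shell ha b
  have hcoord (i : Fin 3) : (∫ z in shell a b, darcyKernel z) i
      = ∫ z in shell a b, darcyKernel z i :=
    ((EuclideanSpace.proj i : R3 →L[ℝ] ℝ).integral_comp_comm hi).symm
  have hint (i : Fin 3) : IntegrableOn (fun z => darcyKernel z i) (shell a b) :=
    (EuclideanSpace.proj i : R3 →L[ℝ] ℝ).integrable_comp hi
  have hflip (i j : Fin 3) (h : ∀ z, darcyKernel (flip i z) j = - darcyKernel z j) :
      ∫ z in shell a b, darcyKernel z j = 0 := by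
    have := setIntegral_shell_comp (flip i) a b (fun z => darcyKernel z j)
    simp only [h, integral_neg] at this
    linarith
  ext i
  rw [hcoord]
  fin_cases i
  -- The horizontal components are odd in one coordinate. For the vertical one, the three images of
  -- 2z₂² - z₀² - z₁² under exchanging coordinates add up to zero.
  · refine hflip 0 0 fun z => ?_
    simp only [darcyKernel, LinearIsometryEquiv.norm_map]
    simp [flip]
  · refine hflip 1 1 fun z => ?_
    simp only [darcyKernel, LinearIsometryEquiv.norm_map]
    simp [flip]
  · have h1 := setIntegral_shell_comp (permute (Equiv.swap 0 2)) a b (fun z => darcyKernel z 2)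
    have h2 := setIntegral_shell_comp (permute (Equiv.swap 1 2)) a b (fun z => darcyKernel z 2)
    have hp (σ : Equiv.Perm (Fin 3)) : IntegrableOn (fun z => darcyKernel (permute σ z) 2)
        (shell a b) := by
      have := ((permute σ).measurePreserving.integrableOn_comp_preimage
        (permute σ).toHomeomorph.measurableEmbedding (s := shell a b)).2 (hint 2)
      have hs : permute σ ⁻¹' shell a b = shell a b := by
        ext z
        simp [shell]
      rwa [hs] at this
    have hsum : ∫ z in shell a b, (darcyKernel z 2 + darcyKernel (permute (Equiv.swap 0 2) z) 2
        + darcyKernel (permute (Equiv.swap 1 2) z) 2) = 0 := by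
      rw [← integral_zero R3 ℝ (μ := volume.restrict (shell a b))]
      congr 1
      ext z
      simp only [darcyKernel, LinearIsometryEquiv.norm_map]
      simp [permute, Equiv.swap_apply_def]
      ring
    have h12 : IntegrableOn (fun z => darcyKernel z 2
        + darcyKernel (permute (Equiv.swap 0 2) z) 2) (shell a b) := (hint 2).add (hp _)
    rw [integral_add h12 (hp _), integral_add (hint 2) (hp _), h1, h2] at hsum
    change ∫ z in shell a b, darcyKernel z 2 = 0
    linarith

/-! ### Integration in horizontal and vertical coordinates -/

lemma measurePreserving_horiz_vert :
    MeasurePreserving (fun z : R3 => (horiz z, z 2)) volume (volume : Measure (R2 × ℝ)) := by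
  have h1 := EuclideanSpace.volume_preserving_symm_measurableEquiv_toLp (Fin 3)
  have h2 := volume_preserving_piFinSuccAbove (fun _ : Fin 3 => ℝ) 2
  have h3 : MeasurePreserving (Prod.map id (WithLp.toLp 2) : ℝ × (Fin 2 → ℝ) → ℝ × R2)
      volume volume :=
    (MeasurePreserving.id volume).prod (PiLp.volume_preserving_toLp (Fin 2))
  have h4 : MeasurePreserving (Prod.swap : ℝ × R2 → R2 × ℝ) volume volume :=
    Measure.measurePreserving_swap
  have h := h4.comp (h3.comp (h2.comp h1))
  have hfun : (fun z : R3 => (horiz z, z 2)) = Prod.swap ∘ Prod.map id (WithLp.toLp 2) ∘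
      MeasurableEquiv.piFinSuccAbove (fun _ : Fin 3 => ℝ) 2 ∘
      (MeasurableEquiv.toLp 2 (Fin 3 → ℝ)).symm := by
    funext z
    refine Prod.ext ?_ rfl
    ext i
    fin_cases i <;> rfl
  rw [hfun]
  exact h

lemma lintegral_horiz_vert {G : R2 × ℝ → ℝ≥0∞} (hG : Measurable G) :
    ∫⁻ z : R3, G (horiz z, z 2) = ∫⁻ w, ∫⁻ v, G (w, v) := by
  rw [measurePreserving_horiz_vert.lintegral_comp hG]
  exact lintegral_prod _ hG.aemeasurable

/-- Graphs are null sets. -/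
lemma ae_vert_ne {h : R2 → ℝ} (hh : Continuous h) : ∀ᵐ x : R3, x 2 ≠ h (horiz x) := by
  have hm : MeasurableSet {p : R2 × ℝ | p.2 = h p.1} :=
    measurableSet_eq_fun measurable_snd (hh.measurable.comp measurable_fst)
  have h0 : (volume : Measure (R2 × ℝ)) {p | p.2 = h p.1} = 0 := by
    change (volume.prod volume) _ = 0
    rw [Measure.measure_prod_null hm]
    refine .of_forall fun w => ?_
    have : Prod.mk w ⁻¹' {p : R2 × ℝ | p.2 = h p.1} = {h w} := by ext; simp
    simp [this]
  rw [ae_iff]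
  simpa using (measurePreserving_horiz_vert.measure_preimage hm.nullMeasurableSet).trans h0

/-! ### Radial integrals in the plane -/

lemma lintegral_radial {S : Set ℝ} (hS : MeasurableSet S) (hS0 : S ⊆ Set.Ioi 0) {φ : ℝ → ℝ}
    (hφ : ∀ r ∈ S, 0 ≤ φ r) (hi : IntegrableOn (fun r => r * φ r) S) :
    ∫⁻ w in {w : R2 | ‖w‖ ∈ S}, ENNReal.ofReal (φ ‖w‖)
      = ENNReal.ofReal (2 * Real.pi * ∫ r in S, r * φ r) := by
  have hm : MeasurableSet {w : R2 | ‖w‖ ∈ S} := measurable_norm hS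
  have hind : (fun r : ℝ => r ^ (Module.finrank ℝ R2 - 1) • S.indicator φ r)
      = S.indicator (fun r => r * φ r) := by
    ext r
    by_cases hr : r ∈ S <;> simp [hr]
  have hint : Integrable (fun w : R2 => S.indicator φ ‖w‖) := by
    rw [integrable_fun_norm_addHaar, hind]
    exact (hi.integrable_indicator hS).integrableOn
  have hval : ∫ w : R2, S.indicator φ ‖w‖ = 2 * Real.pi * ∫ r in S, r * φ r := by
    rw [integral_fun_norm_addHaar, hind, setIntegral_indicator hS,
      Set.inter_eq_right.2 hS0, measureReal_def, EuclideanSpace.volume_ball_fin_two]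
    simp [ENNReal.toReal_ofReal Real.pi_pos.le]
    ring
  rw [← hval, ofReal_integral_eq_lintegral_ofReal hint
    (.of_forall fun w => Set.indicator_nonneg hφ _), ← lintegral_indicator hm]
  congr 1
  ext w
  by_cases hw : ‖w‖ ∈ S <;> simp [hw]

lemma lintegral_annulus_inv_sq {a b : ℝ} (ha : 0 < a) (hab : a ≤ b) :
    ∫⁻ w in {w : R2 | ‖w‖ ∈ Set.Ioc a b}, ENNReal.ofReal (‖w‖ ^ 2)⁻¹
      = ENNReal.ofReal (2 * Real.pi * Real.log (b / a)) := by
  have heq : Set.EqOn (fun r : ℝ => r * (r ^ 2)⁻¹) (fun r => r⁻¹) (Set.Ioc a b) := by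
    intro r hr
    have : r ≠ 0 := (ha.trans hr.1).ne'
    simp only
    field_simp
  have hab0 : (0 : ℝ) ∉ Set.uIcc a b := by
    rw [Set.uIcc_of_le hab]; exact fun h => ha.not_ge h.1
  rw [lintegral_radial (φ := fun r => (r ^ 2)⁻¹) measurableSet_Ioc (fun r hr => ha.trans hr.1)
      (fun r _ => by positivity),
    setIntegral_congr_fun measurableSet_Ioc heq, ← intervalIntegral.integral_of_le hab,
    integral_inv hab0]
  rw [integrableOn_congr_fun heq measurableSet_Ioc]
  exact (intervalIntegrable_iff_integrableOn_Ioc_of_le hab).1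
    (intervalIntegral.intervalIntegrable_inv (fun x hx h => hab0 (h ▸ hx)) continuousOn_id)

lemma lintegral_exterior_inv_cube {a : ℝ} (ha : 0 < a) :
    ∫⁻ w in {w : R2 | ‖w‖ ∈ Set.Ioi a}, ENNReal.ofReal (‖w‖ ^ 3)⁻¹
      = ENNReal.ofReal (2 * Real.pi * a⁻¹) := by
  have heq : Set.EqOn (fun r : ℝ => r * (r ^ 3)⁻¹) (fun r => r ^ (-2 : ℝ)) (Set.Ioi a) := by
    intro r hr
    have hr0 : 0 < r := ha.trans hr
    simp only
    rw [Real.rpow_neg hr0.le, Real.rpow_two]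
    field_simp
  rw [lintegral_radial (φ := fun r => (r ^ 3)⁻¹) measurableSet_Ioi (fun r hr => ha.trans hr)
      (fun r hr => by have : 0 < r := ha.trans hr; positivity),
    setIntegral_congr_fun measurableSet_Ioi heq, integral_Ioi_rpow_of_lt (by norm_num) ha]
  · norm_num [Real.rpow_neg_one]
  rw [integrableOn_congr_fun heq measurableSet_Ioi]
  exact integrableOn_Ioi_rpow_of_lt (by norm_num) ha

lemma lintegral_disc_rpow {γ δ : ℝ} (hγ : 0 < γ) (hδ : 0 ≤ δ) :
    ∫⁻ w in {w : R2 | ‖w‖ ∈ Set.Ioc 0 δ}, ENNReal.ofReal (‖w‖ ^ (γ - 2))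
      = ENNReal.ofReal (2 * Real.pi * (δ ^ γ / γ)) := by
  have heq : Set.EqOn (fun r : ℝ => r * r ^ (γ - 2)) (fun r => r ^ (γ - 1)) (Set.Ioc 0 δ) := by
    intro r hr
    simp only
    rw [show γ - 1 = 1 + (γ - 2) by ring, Real.rpow_add hr.1, Real.rpow_one]
  rw [lintegral_radial (φ := fun r => r ^ (γ - 2)) measurableSet_Ioc (fun r hr => hr.1)
      (fun r hr => Real.rpow_nonneg hr.1.le _),
    setIntegral_congr_fun measurableSet_Ioc heq, ← intervalIntegral.integral_of_le hδ,
    integral_rpow (Or.inl (by linarith))]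
  · simp [Real.zero_rpow hγ.ne']
  rw [integrableOn_congr_fun heq measurableSet_Ioc]
  exact (intervalIntegrable_iff_integrableOn_Ioc_of_le hδ).1
    (intervalIntegral.intervalIntegrable_rpow' (by linarith))

lemma lintegral_line_inv {ρ : ℝ} (hρ : 0 < ρ) :
    ∫⁻ v : ℝ, ENNReal.ofReal (2 / (ρ * (ρ ^ 2 + v ^ 2))) = ENNReal.ofReal (2 * Real.pi / ρ ^ 2) := by
  have heq : (fun v : ℝ => 2 / (ρ * (ρ ^ 2 + v ^ 2)))
      = fun v => 2 / ρ ^ 3 * (1 + (v / ρ) ^ 2)⁻¹ := by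
    ext v
    have : 0 < ρ ^ 2 + v ^ 2 := by positivity
    field_simp
  have hint : Integrable (fun v : ℝ => 2 / (ρ * (ρ ^ 2 + v ^ 2))) := by
    rw [heq]
    exact (integrable_inv_one_add_sq.comp_div hρ.ne').const_mul _
  rw [← ofReal_integral_eq_lintegral_ofReal hint (.of_forall fun v => by positivity), heq,
    integral_const_mul, Measure.integral_comp_div (fun v : ℝ => (1 + v ^ 2)⁻¹),
    integral_univ_inv_one_add_sq, abs_of_pos hρ]
  congr 1
  simp only [smul_eq_mul]
  field_simp

/-! ### Truncated integrals of the kernel -/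

/-- The domain of the truncated singular integral, centred at the origin. -/
def slab (ε H : ℝ) : Set R3 := {z | ε < ‖z‖ ∧ |z 2| < H}

lemma measurable_vert : Measurable fun z : R3 => z 2 := by fun_prop

lemma measurableSet_slab (ε H : ℝ) : MeasurableSet (slab ε H) :=
  (measurableSet_lt measurable_const measurable_norm).inter
    (measurableSet_lt measurable_vert.abs measurable_const)

/-- In a slab of finite height the kernel is dominated by max(|w|, ε)^(-3), which is integrable over
the plane. The vertical cutoff therefore suffices for absolute convergence. -/
lemma integrableOn_slab {ε : ℝ} (hε : 0 < ε) (H : ℝ) : IntegrableOn darcyKernel (slab ε H) := by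
  refine ⟨measurable_darcyKernel.aestronglyMeasurable, ?_⟩
  set V : Set ℝ := {v | |v| < H}
  have hV : MeasurableSet V := measurableSet_lt measurable_id.abs measurable_const
  have hVfin : volume V < ⊤ := by
    refine (measure_mono (t := Metric.ball 0 H) fun v hv => ?_).trans_lt measure_ball_lt_top
    simpa [V] using hv
  let G : R2 × ℝ → ℝ≥0∞ := fun p =>
    ENNReal.ofReal ((max ‖p.1‖ ε) ^ 3)⁻¹ * V.indicator 1 p.2
  have hG : Measurable G :=
    Measurable.mul (by fun_prop) ((measurable_one.indicator hV).comp measurable_snd)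
  have hle : ∫⁻ z in slab ε H, ‖darcyKernel z‖ₑ ≤ ∫⁻ z : R3, G (horiz z, z 2) := by
    rw [← lintegral_indicator (measurableSet_slab ε H)]
    refine lintegral_mono fun z => ?_
    by_cases hz : z ∈ slab ε H
    · have hz2 : z 2 ∈ V := hz.2
      simp only [hz, Set.indicator_of_mem, G, hz2, Pi.one_apply, mul_one]
      rw [← ofReal_norm]
      refine ENNReal.ofReal_le_ofReal ((norm_darcyKernel_le z).trans ?_)
      have := max_le (norm_horiz_le z) hz.1.le
      have h0 : 0 < max ‖horiz z‖ ε := lt_max_of_lt_right hε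
      gcongr
    · simp [hz]
  refine hle.trans_lt ?_
  rw [lintegral_horiz_vert hG]
  have hin (w : R2) : ∫⁻ v, G (w, v) = ENNReal.ofReal ((max ‖w‖ ε) ^ 3)⁻¹ * volume V := by
    simp only [G]
    rw [lintegral_const_mul _ (measurable_one.indicator hV), lintegral_indicator_one hV]
  simp_rw [hin]
  rw [lintegral_mul_const _ (by fun_prop)]
  refine ENNReal.mul_lt_top ?_ hVfin
  rw [← lintegral_add_compl _ (measurable_norm measurableSet_Ioi : MeasurableSet {w : R2 | ‖w‖ ∈ Set.Ioi ε})]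
  refine ENNReal.add_lt_top.2 ⟨?_, ?_⟩
  · refine (setLIntegral_mono' (measurable_norm measurableSet_Ioi)
      (g := fun w : R2 => ENNReal.ofReal (‖w‖ ^ 3)⁻¹) fun w hw => ?_).trans_lt
      ((lintegral_exterior_inv_cube hε).trans_lt ENNReal.ofReal_lt_top)
    rw [max_eq_left (le_of_lt hw)]
  · refine (lintegral_mono (g := fun _ : R2 => ENNReal.ofReal (ε ^ 3)⁻¹) fun w => ?_).trans_lt ?_
    · refine ENNReal.ofReal_le_ofReal ?_
      gcongr
      exact le_max_right _ _
    · rw [setLIntegral_const]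
      refine ENNReal.mul_lt_top ENNReal.ofReal_lt_top ?_
      refine (measure_mono (t := Metric.closedBall 0 ε) fun w hw => ?_).trans_lt
        measure_closedBall_lt_top
      simpa using hw

lemma slab_eq_union {ε r H : ℝ} (h : ε ≤ r) (hr : r < H) :
    slab ε H = slab r H ∪ shell ε r := by
  ext z
  have hz := abs_vert_le z
  simp only [slab, shell, Set.mem_union, Set.mem_ofPred_eq]
  constructor
  · rintro ⟨h1, h2⟩
    rcases lt_or_ge r ‖z‖ with h3 | h3
    · exact Or.inl ⟨h3, h2⟩
    · exact Or.inr ⟨h1, h3⟩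
  · rintro (⟨h1, h2⟩ | ⟨h1, h2⟩)
    · exact ⟨h.trans_lt h1, h2⟩
    · exact ⟨h1, by linarith⟩

lemma disjoint_slab_shell (ε r H : ℝ) : Disjoint (slab r H) (shell ε r) :=
  Set.disjoint_left.2 fun _ h1 h2 => h1.1.not_ge h2.2

lemma setIntegral_slab_of_le {ε r H : ℝ} (hε : 0 < ε) (h : ε ≤ r) (hr : r < H) :
    ∫ z in slab ε H, darcyKernel z = ∫ z in slab r H, darcyKernel z := by
  rw [slab_eq_union h hr, setIntegral_union (disjoint_slab_shell ε r H) (measurableSet_shell ε r)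
    (integrableOn_slab (hε.trans_le h) H) (integrableOn_shell hε r), setIntegral_shell hε, add_zero]

open scoped Pointwise in
lemma setIntegral_slab_scale {c : ℝ} (hc : 0 < c) (ε H : ℝ) :
    ∫ z in slab ε H, darcyKernel z = ∫ z in slab (c * ε) (c * H), darcyKernel z := by
  have h := Measure.setIntegral_comp_smul_of_pos (volume : Measure R3) darcyKernel (slab ε H) hc
  have hset : c • slab ε H = slab (c * ε) (c * H) := by
    ext z
    rw [Set.mem_smul_set_iff_inv_smul_mem₀ hc.ne']
    simp only [slab, Set.mem_ofPred_eq, norm_smul, PiLp.smul_apply, smul_eq_mul, abs_mul, norm_inv,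
      Real.norm_of_nonneg hc.le, abs_inv, abs_of_pos hc]
    rw [lt_inv_mul_iff₀ hc, inv_mul_lt_iff₀ hc]
  simp only [darcyKernel_smul hc, integral_smul, hset, finrank_euclideanSpace_fin] at h
  exact smul_right_injective R3 (by positivity : (c ^ 3)⁻¹ ≠ 0) h

/-- The truncated integrals of the kernel are independent of the truncation. -/
lemma setIntegral_slab {ε H : ℝ} (hε : 0 < ε) (hH : ε < H) :
    ∫ z in slab ε H, darcyKernel z = ∫ z in slab 1 2, darcyKernel z := by
  have hH0 : 0 < H := hε.trans hH
  -- Homogeneity of degree -3 cancels the Jacobian, so the slab can be rescaled to half-height 2.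
  -- The inner radius is then moved to 1 across a shell of mean zero.
  rw [setIntegral_slab_scale (c := 2 / H) (by positivity),
    show 2 / H * H = 2 by field_simp]
  have h1 : 0 < 2 / H * ε := by positivity
  have h2 : 2 / H * ε < 2 := by
    rw [div_mul_eq_mul_div, div_lt_iff₀ hH0]; linarith
  rcases le_total (2 / H * ε) 1 with h | h
  · exact setIntegral_slab_of_le h1 h (by norm_num)
  · exact (setIntegral_slab_of_le one_pos h h2).symm

/-! ### The region on one side of a graph -/

/-- The indicator function of the region above the graph of `s`. -/
def side (s : R2 → ℝ) (z : R3) : ℝ := if s (horiz z) ≤ z 2 then 1 else 0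

/-- The deviation of the region above the graph of `s` from being exchanged with its complement by
the reflection in the origin. -/
def asym (s : R2 → ℝ) (z : R3) : ℝ := side s z + side s (-z) - 1

lemma measurable_side {s : R2 → ℝ} (hs : Continuous s) : Measurable (side s) :=
  Measurable.ite (measurableSet_le (hs.comp continuous_horiz).measurable measurable_vert)
    measurable_const measurable_const

lemma measurable_asym {s : R2 → ℝ} (hs : Continuous s) : Measurable (asym s) :=
  ((measurable_side hs).add ((measurable_side hs).comp measurable_neg)).sub measurable_const

lemma abs_side_le (s : R2 → ℝ) (z : R3) : |side s z| ≤ 1 := by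
  unfold side; split_ifs <;> simp

lemma abs_asym_le (s : R2 → ℝ) (z : R3) : |asym s z| ≤ 1 := by
  unfold asym side; split_ifs <;> simp

/-- The point -z lies above the graph exactly when z₂ ≤ -s(-w), with w the horizontal part of z.
Outside the interval between s(w) and -s(-w), exactly one of z and -z is above. -/
lemma asym_eq_zero {s : R2 → ℝ} {z : R3}
    (hz : z 2 ∉ Set.uIcc (s (horiz z)) (-s (-horiz z))) : asym s z = 0 := by
  rw [Set.mem_uIcc] at hz
  push Not at hz
  simp only [asym, side, horiz_neg, PiLp.neg_apply]
  split_ifs with h1 h2 h2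
  · linarith [hz.1 h1]
  · simp
  · simp
  · linarith [hz.2 (by linarith)]

lemma integrableOn_smul_darcyKernel {χ : R3 → ℝ} (hχ : Measurable χ) (hb : ∀ z, |χ z| ≤ 1)
    {S : Set R3} (hS : IntegrableOn darcyKernel S) :
    IntegrableOn (fun z => χ z • darcyKernel z) S :=
  Integrable.bdd_smul hS 1 hχ.aestronglyMeasurable (.of_forall hb)

/-- The kernel and the slab are invariant under z ↦ -z, so `side s` may be averaged with its
reflection. -/
lemma setIntegral_side_smul {s : R2 → ℝ} (hs : Continuous s) {ε : ℝ} (hε : 0 < ε) (H : ℝ) :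
    ∫ z in slab ε H, side s z • darcyKernel z
      = (1 / 2 : ℝ) • ((∫ z in slab ε H, darcyKernel z)
        + ∫ z in slab ε H, asym s z • darcyKernel z) := by
  have hi := integrableOn_slab hε H
  have h1 := integrableOn_smul_darcyKernel (measurable_side hs) (abs_side_le s) hi
  have h2 : IntegrableOn (fun z => side s (-z) • darcyKernel z) (slab ε H) :=
    integrableOn_smul_darcyKernel ((measurable_side hs).comp measurable_neg)
      (fun z => abs_side_le s (-z)) hi
  have hneg : ∫ z in slab ε H, side s (-z) • darcyKernel z
      = ∫ z in slab ε H, side s z • darcyKernel z := by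
    have h := (LinearIsometryEquiv.neg ℝ (E := R3)).measurePreserving.setIntegral_preimage_emb
      (LinearIsometryEquiv.neg ℝ (E := R3)).toHomeomorph.measurableEmbedding
      (fun z => side s z • darcyKernel z) (slab ε H)
    have hset : (LinearIsometryEquiv.neg ℝ (E := R3)) ⁻¹' slab ε H = slab ε H := by
      ext z
      simp [slab]
    rw [← h, hset]
    simp only [LinearIsometryEquiv.coe_neg, darcyKernel_neg]
  have hsum : ∫ z in slab ε H, asym s z • darcyKernel z
      = (∫ z in slab ε H, side s z • darcyKernel z)
        + (∫ z in slab ε H, side s (-z) • darcyKernel z) - ∫ z in slab ε H, darcyKernel z := by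
    have h12 : IntegrableOn (fun z => side s z • darcyKernel z + side s (-z) • darcyKernel z)
        (slab ε H) := h1.add h2
    rw [← integral_add h1 h2, ← integral_sub h12 hi]
    simp only [asym, sub_smul, add_smul, one_smul]
  rw [hsum, hneg, add_sub_cancel, ← two_smul ℝ (∫ z in slab ε H, side s z • darcyKernel z),
    smul_smul]
  norm_num

/-- The truncated integrals are eventually independent of the truncation. -/
lemma setIntegral_asym_smul {s : R2 → ℝ} (hs : Continuous s) {ε r H₀ H κ : ℝ} (hε : 0 < ε)
    (hr : ε ≤ r) (hr₀ : r < H₀) (hH : H₀ ≤ H) (hκ : ∀ z, ‖z‖ ≤ r → asym s z = κ)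
    (h0 : ∀ z : R3, H₀ ≤ |z 2| → asym s z = 0) :
    ∫ z in slab ε H, asym s z • darcyKernel z = ∫ z in slab r H₀, asym s z • darcyKernel z := by
  have hi (S : Set R3) (hS : IntegrableOn darcyKernel S) :
      IntegrableOn (fun z => asym s z • darcyKernel z) S :=
    integrableOn_smul_darcyKernel (measurable_asym hs) (abs_asym_le s) hS
  -- The weight is the constant κ on this shell, where the kernel has mean zero.
  have hshell : ∫ z in shell ε r, asym s z • darcyKernel z = 0 := by
    have heq : Set.EqOn (fun z => asym s z • darcyKernel z) (fun z => κ • darcyKernel z)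
        (shell ε r) := fun z hz => by simp only [hκ z hz.2]
    rw [setIntegral_congr_fun (measurableSet_shell ε r) heq, integral_smul, setIntegral_shell hε,
      smul_zero]
  rw [slab_eq_union hr (hr₀.trans_le hH), setIntegral_union (disjoint_slab_shell ε r H)
    (measurableSet_shell ε r) (hi _ (integrableOn_slab (hε.trans_le hr) H))
    (hi _ (integrableOn_shell hε r)), hshell, add_zero]
  refine setIntegral_eq_of_subset_of_forall_sdiff_eq_zero (measurableSet_slab r H)
    (fun z hz => ⟨hz.1, hz.2.trans_le hH⟩) fun z hz => ?_
  have : H₀ ≤ |z 2| := by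
    by_contra h
    exact hz.2 ⟨hz.1.1, not_le.1 h⟩
  rw [h0 z this, zero_smul]

/-! ### Estimates over cylindrical shells -/

lemma measurableSet_outer_cyl {S : Set ℝ} (hS : MeasurableSet S) (r : ℝ) :
    MeasurableSet {z : R3 | r < ‖z‖ ∧ ‖horiz z‖ ∈ S} :=
  (measurableSet_lt measurable_const measurable_norm).inter
    (continuous_horiz.norm.measurable hS)

/-- One factor ‖z‖ is at least ρ, and 2‖z‖² ≥ ρ² + z₂². The resulting majorant is a Cauchy profile
in the vertical variable, with an explicit integral. -/
lemma inv_norm_cube_le {z : R3} {ρ : ℝ} (hρ : 0 < ρ) (h : ρ ≤ ‖z‖) :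
    (‖z‖ ^ 3)⁻¹ ≤ 2 / (ρ * (ρ ^ 2 + z 2 ^ 2)) := by
  have h2 : z 2 ^ 2 ≤ ‖z‖ ^ 2 := by
    rw [← sq_abs (z 2)]
    have := abs_vert_le z
    gcongr
  have h3 : ρ ^ 2 ≤ ‖z‖ ^ 2 := by gcongr
  have hz : 0 < ‖z‖ := hρ.trans_le h
  rw [inv_eq_one_div, div_le_div_iff₀ (by positivity) (by positivity)]
  nlinarith [mul_le_mul h (add_le_add h3 h2) (by positivity) hz.le]

/-- This bound uses only |`asym s`| ≤ 1. It serves where the support of `asym s` may be tall. -/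
lemma lintegral_cyl_le {S : Set ℝ} (hS : MeasurableSet S) {r : ℝ} (hr : 0 < r) (s : R2 → ℝ) :
    ∫⁻ z in {z : R3 | r < ‖z‖ ∧ ‖horiz z‖ ∈ S}, ‖asym s z • darcyKernel z‖ₑ
      ≤ ∫⁻ w in {w : R2 | ‖w‖ ∈ S}, ENNReal.ofReal (2 * Real.pi / max ‖w‖ r ^ 2) := by
  have hS' : MeasurableSet {w : R2 | ‖w‖ ∈ S} := measurable_norm hS
  let G : R2 × ℝ → ℝ≥0∞ := fun p => {w : R2 | ‖w‖ ∈ S}.indicator 1 p.1 *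
    ENNReal.ofReal (2 / (max ‖p.1‖ r * (max ‖p.1‖ r ^ 2 + p.2 ^ 2)))
  have hG : Measurable G :=
    Measurable.mul ((measurable_one.indicator hS').comp measurable_fst) (by fun_prop)
  calc _ ≤ ∫⁻ z : R3, G (horiz z, z 2) := by
        rw [← lintegral_indicator (measurableSet_outer_cyl hS r)]
        refine lintegral_mono fun z => ?_
        by_cases hz : z ∈ {z : R3 | r < ‖z‖ ∧ ‖horiz z‖ ∈ S}
        · have hz2 : horiz z ∈ {w : R2 | ‖w‖ ∈ S} := hz.2
          simp only [hz, Set.indicator_of_mem, G, hz2, Pi.one_apply, one_mul]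
          rw [← ofReal_norm, norm_smul, Real.norm_eq_abs]
          refine ENNReal.ofReal_le_ofReal ?_
          calc _ ≤ 1 * (‖z‖ ^ 3)⁻¹ := by
                gcongr
                · exact abs_asym_le s z
                · exact norm_darcyKernel_le z
            _ ≤ _ := by
                rw [one_mul]
                exact inv_norm_cube_le (lt_max_of_lt_right hr)
                  (max_le (norm_horiz_le z) hz.1.le)
        · simp [hz]
    _ = ∫⁻ w, ∫⁻ v, G (w, v) := lintegral_horiz_vert hG
    _ = _ := by
        rw [← lintegral_indicator hS']
        congr 1
        ext w
        simp only [G]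
        rw [lintegral_const_mul _ (by fun_prop), lintegral_line_inv (lt_max_of_lt_right hr)]
        by_cases hw : w ∈ {w : R2 | ‖w‖ ∈ S} <;> simp [hw]

/-- This bound exploits that `asym s` lives on a vertical interval of length |s(w) + s(-w)|, on
which the kernel is at most |w|^(-3). -/
lemma lintegral_cyl_le_asym {S : Set ℝ} (hS : MeasurableSet S) (hS0 : S ⊆ Set.Ioi 0) (r : ℝ)
    {s : R2 → ℝ} (hs : Continuous s) :
    ∫⁻ z in {z : R3 | r < ‖z‖ ∧ ‖horiz z‖ ∈ S}, ‖asym s z • darcyKernel z‖ₑ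
      ≤ ∫⁻ w in {w : R2 | ‖w‖ ∈ S}, ENNReal.ofReal (|s w + s (-w)| * (‖w‖ ^ 3)⁻¹) := by
  have hS' : MeasurableSet {w : R2 | ‖w‖ ∈ S} := measurable_norm hS
  let T : Set (R2 × ℝ) := {p | p.2 ∈ Set.uIcc (s p.1) (-s (-p.1))}
  have hT : MeasurableSet T := by
    have hc : Continuous fun p : R2 × ℝ => s p.1 := by fun_prop
    have hc' : Continuous fun p : R2 × ℝ => -s (-p.1) := by fun_prop
    exact (measurableSet_le (hc.min hc').measurable measurable_snd).inter
      (measurableSet_le measurable_snd (hc.max hc').measurable)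
  let G : R2 × ℝ → ℝ≥0∞ := fun p => {w : R2 | ‖w‖ ∈ S}.indicator 1 p.1 *
    ENNReal.ofReal (‖p.1‖ ^ 3)⁻¹ * T.indicator 1 p
  have hG : Measurable G :=
    (Measurable.mul ((measurable_one.indicator hS').comp measurable_fst) (by fun_prop)).mul
      (measurable_one.indicator hT)
  calc _ ≤ ∫⁻ z : R3, G (horiz z, z 2) := by
        rw [← lintegral_indicator (measurableSet_outer_cyl hS r)]
        refine lintegral_mono fun z => ?_
        by_cases hz : z ∈ {z : R3 | r < ‖z‖ ∧ ‖horiz z‖ ∈ S}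
        · have hz2 : horiz z ∈ {w : R2 | ‖w‖ ∈ S} := hz.2
          have hpos : 0 < ‖horiz z‖ := hS0 hz.2
          by_cases hzT : (horiz z, z 2) ∈ T
          · simp only [hz, Set.indicator_of_mem, G, hz2, hzT, Pi.one_apply, one_mul, mul_one]
            rw [← ofReal_norm, norm_smul, Real.norm_eq_abs]
            refine ENNReal.ofReal_le_ofReal ?_
            calc _ ≤ 1 * (‖z‖ ^ 3)⁻¹ := by
                  gcongr
                  · exact abs_asym_le s z
                  · exact norm_darcyKernel_le z
              _ ≤ _ := by
                  rw [one_mul]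
                  have := norm_horiz_le z
                  gcongr
          · have : asym s z = 0 := asym_eq_zero hzT
            rw [Set.indicator_of_mem hz, this]
            simp
        · simp [hz]
    _ = ∫⁻ w, ∫⁻ v, G (w, v) := lintegral_horiz_vert hG
    _ = _ := by
        rw [← lintegral_indicator hS']
        congr 1
        ext w
        have hv : ∫⁻ v, T.indicator 1 (w, v) = ENNReal.ofReal |s w + s (-w)| := by
          have : (fun v => T.indicator (1 : R2 × ℝ → ℝ≥0∞) (w, v))
              = (Set.uIcc (s w) (-s (-w))).indicator 1 := by
            ext v
            rfl
          rw [this, lintegral_indicator_one measurableSet_uIcc, Real.volume_interval, abs_sub_comm]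
          congr 2
          ring
        have hm : Measurable fun v => T.indicator (1 : R2 × ℝ → ℝ≥0∞) (w, v) :=
          (measurable_one.indicator hT).comp measurable_prodMk_left
        simp only [G]
        rw [lintegral_const_mul _ hm, hv]
        by_cases hw : w ∈ {w : R2 | ‖w‖ ∈ S}
        · simp [hw, ENNReal.ofReal_mul, mul_comm]
        · simp [hw]

lemma lintegral_core_le {r : ℝ} (hr : 0 < r) (s : R2 → ℝ) :
    ∫⁻ z in {z : R3 | r < ‖z‖ ∧ ‖horiz z‖ ∈ Set.Iic r}, ‖asym s z • darcyKernel z‖ₑ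
      ≤ ENNReal.ofReal (2 * Real.pi ^ 2) := by
  refine (lintegral_cyl_le measurableSet_Iic hr s).trans ?_
  calc _ ≤ ∫⁻ _ in {w : R2 | ‖w‖ ∈ Set.Iic r}, ENNReal.ofReal (2 * Real.pi / r ^ 2) := by
        refine lintegral_mono fun w => ENNReal.ofReal_le_ofReal ?_
        have := Real.pi_pos
        gcongr
        exact le_max_right _ _
    _ = ENNReal.ofReal (2 * Real.pi / r ^ 2) * volume (Metric.closedBall (0 : R2) r) := by
        rw [setLIntegral_const]
        congr 2
        ext w
        simp
    _ = _ := by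
        rw [EuclideanSpace.volume_closedBall_fin_two, ← ENNReal.ofReal_pow hr.le]
        have := Real.pi_pos
        rw [← ENNReal.ofReal_mul (by positivity), ← ENNReal.ofReal_mul (by positivity)]
        congr 1
        field_simp

lemma lintegral_annulus_le {r a b : ℝ} (hr : 0 < r) (ha : 0 < a) (hab : a ≤ b) (s : R2 → ℝ) :
    ∫⁻ z in {z : R3 | r < ‖z‖ ∧ ‖horiz z‖ ∈ Set.Ioc a b}, ‖asym s z • darcyKernel z‖ₑ
      ≤ ENNReal.ofReal (4 * Real.pi ^ 2 * Real.log (b / a)) := by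
  have hpi := Real.pi_pos
  refine (lintegral_cyl_le measurableSet_Ioc hr s).trans ?_
  calc _ ≤ ∫⁻ w in {w : R2 | ‖w‖ ∈ Set.Ioc a b},
          ENNReal.ofReal (2 * Real.pi) * ENNReal.ofReal (‖w‖ ^ 2)⁻¹ := by
        refine setLIntegral_mono' (measurable_norm measurableSet_Ioc) fun w hw => ?_
        have hw0 : 0 < ‖w‖ := ha.trans hw.1
        rw [← ENNReal.ofReal_mul (by positivity), ← div_eq_mul_inv]
        refine ENNReal.ofReal_le_ofReal ?_
        gcongr
        exact le_max_left _ _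
    _ = _ := by
        rw [lintegral_const_mul _ (by fun_prop), lintegral_annulus_inv_sq ha hab,
          ← ENNReal.ofReal_mul (by positivity)]
        congr 1
        ring

lemma lintegral_inner_le {s : R2 → ℝ} (hs : Continuous s) {A M γ δ : ℝ} (hA : 0 < A) (hM : 0 ≤ M)
    (hγ : 0 < γ) (hδ : 0 ≤ δ) (hsA : ∀ w, |s w + s (-w)| ≤ 2 * A + 2 * M * ‖w‖ ^ (1 + γ)) (r : ℝ) :
    ∫⁻ z in {z : R3 | r < ‖z‖ ∧ ‖horiz z‖ ∈ Set.Ioc A δ}, ‖asym s z • darcyKernel z‖ₑ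
      ≤ ENNReal.ofReal (4 * Real.pi + 4 * Real.pi * (M * δ ^ γ / γ)) := by
  have hpi := Real.pi_pos
  refine (lintegral_cyl_le_asym measurableSet_Ioc (fun x hx => hA.trans hx.1) r hs).trans ?_
  calc _ ≤ ∫⁻ w in {w : R2 | ‖w‖ ∈ Set.Ioc A δ},
          (ENNReal.ofReal (2 * A) * ENNReal.ofReal (‖w‖ ^ 3)⁻¹
            + ENNReal.ofReal (2 * M) * ENNReal.ofReal (‖w‖ ^ (γ - 2))) := by
        refine setLIntegral_mono' (measurable_norm measurableSet_Ioc) fun w hw => ?_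
        have hw0 : 0 < ‖w‖ := hA.trans hw.1
        rw [← ENNReal.ofReal_mul (by positivity), ← ENNReal.ofReal_mul (by positivity),
          ← ENNReal.ofReal_add (by positivity) (by positivity)]
        refine ENNReal.ofReal_le_ofReal ?_
        calc _ ≤ (2 * A + 2 * M * ‖w‖ ^ (1 + γ)) * (‖w‖ ^ 3)⁻¹ := by gcongr; exact hsA w
          _ = _ := by
            rw [show γ - 2 = (1 + γ) - (3 : ℕ) by push_cast; ring, Real.rpow_sub_natCast hw0.ne']
            ring
    _ = ENNReal.ofReal (2 * A) * (∫⁻ w in {w : R2 | ‖w‖ ∈ Set.Ioc A δ},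
            ENNReal.ofReal (‖w‖ ^ 3)⁻¹)
          + ENNReal.ofReal (2 * M) * ∫⁻ w in {w : R2 | ‖w‖ ∈ Set.Ioc A δ},
            ENNReal.ofReal (‖w‖ ^ (γ - 2)) := by
        rw [lintegral_add_left (by fun_prop), lintegral_const_mul _ (by fun_prop),
          lintegral_const_mul _ (by fun_prop)]
    _ ≤ ENNReal.ofReal (2 * A) * (∫⁻ w in {w : R2 | ‖w‖ ∈ Set.Ioi A},
            ENNReal.ofReal (‖w‖ ^ 3)⁻¹)
          + ENNReal.ofReal (2 * M) * ∫⁻ w in {w : R2 | ‖w‖ ∈ Set.Ioc 0 δ},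
            ENNReal.ofReal (‖w‖ ^ (γ - 2)) := by
        gcongr
        · exact fun x hx => hx.1
    _ = _ := by
        rw [lintegral_exterior_inv_cube hA, lintegral_disc_rpow hγ hδ,
          ← ENNReal.ofReal_mul (by positivity), ← ENNReal.ofReal_mul (by positivity),
          ← ENNReal.ofReal_add (by positivity) (by positivity)]
        congr 1
        field_simp
        ring

lemma lintegral_outer_le {s : R2 → ℝ} (hs : Continuous s) {B R : ℝ} (hR : 0 < R)
    (hsB : ∀ w, |s w + s (-w)| ≤ B) (r : ℝ) :
    ∫⁻ z in {z : R3 | r < ‖z‖ ∧ ‖horiz z‖ ∈ Set.Ioi R}, ‖asym s z • darcyKernel z‖ₑ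
      ≤ ENNReal.ofReal (2 * Real.pi * (B / R)) := by
  have hB : 0 ≤ B := (abs_nonneg _).trans (hsB 0)
  refine (lintegral_cyl_le_asym measurableSet_Ioi (fun x hx => hR.trans hx) r hs).trans ?_
  calc _ ≤ ∫⁻ w in {w : R2 | ‖w‖ ∈ Set.Ioi R},
          ENNReal.ofReal B * ENNReal.ofReal (‖w‖ ^ 3)⁻¹ := by
        refine lintegral_mono fun w => ?_
        rw [← ENNReal.ofReal_mul hB]
        refine ENNReal.ofReal_le_ofReal ?_
        gcongr
        exact hsB w
    _ = _ := by
        rw [lintegral_const_mul _ (by fun_prop), lintegral_exterior_inv_cube hR,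
          ← ENNReal.ofReal_mul hB]
        congr 1
        ring

/-- The logarithmic bound for the asymmetric part of the singular integral. -/
lemma lintegral_asym_le {s : R2 → ℝ} (hs : Continuous s) {γ M N : ℝ} (hγ : 0 < γ)
    (hM : 0 ≤ M) (hN : 0 ≤ N) (h0 : s 0 ≠ 0)
    (h1 : ∀ w, |s w + s (-w)| ≤ 2 * |s 0| + 2 * M * ‖w‖ ^ (1 + γ))
    (h2 : ∀ w, |s w + s (-w)| ≤ 2 * |s 0| + 4 * N) :
    ∫⁻ z in {z : R3 | |s 0| / (4 * (1 + M)) < ‖z‖}, ‖asym s z • darcyKernel z‖ₑ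
      ≤ ENNReal.ofReal (2 * Real.pi ^ 2 + 4 * Real.pi ^ 2 * Real.log (4 * (1 + M))
        + (4 * Real.pi + 4 * Real.pi * (1 / γ))
        + 4 * Real.pi ^ 2 * (Real.log (1 + N) + 1 / γ * Real.log (1 + M))
        + 12 * Real.pi) := by
  have hpi := Real.pi_pos
  set A := |s 0|
  have hA : 0 < A := abs_pos.2 h0
  set r := A / (4 * (1 + M)) with hr_def
  have hr : 0 < r := by positivity
  have hrA : r ≤ A := div_le_self hA.le (by linarith)
  -- This choice gives M δ^γ ≤ 1, while log(1/δ) costs only (1/γ) log(1 + M).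
  set δ := (1 + M) ^ (-(1 / γ)) with hδ_def
  have hδ : 0 < δ := by positivity
  have hδ1 : δ ≤ 1 := Real.rpow_le_one_of_one_le_of_nonpos (by linarith)
    (by have : 0 < 1 / γ := by positivity
        linarith)
  have hδR : max A δ ≤ max A (1 + N) := max_le_max_left _ (by linarith)
  -- The maxima allow A to lie anywhere relative to δ and 1 + N; some of the annuli may then be
  -- empty.
  have hcover : {z : R3 | r < ‖z‖} ⊆ ((({z : R3 | r < ‖z‖ ∧ ‖horiz z‖ ∈ Set.Iic r}
      ∪ {z : R3 | r < ‖z‖ ∧ ‖horiz z‖ ∈ Set.Ioc r A})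
      ∪ {z : R3 | r < ‖z‖ ∧ ‖horiz z‖ ∈ Set.Ioc A δ})
      ∪ {z : R3 | r < ‖z‖ ∧ ‖horiz z‖ ∈ Set.Ioc (max A δ) (max A (1 + N))})
      ∪ {z : R3 | r < ‖z‖ ∧ ‖horiz z‖ ∈ Set.Ioi (max A (1 + N))} := by
    intro z hz
    have hz' : r < ‖z‖ := hz
    simp only [Set.mem_union, Set.mem_ofPred_eq, Set.mem_Iic, Set.mem_Ioc, Set.mem_Ioi, hz',
      true_and, max_lt_iff, le_max_iff]
    grind
  have hMδ : M * δ ^ γ ≤ 1 := by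
    rw [hδ_def, ← Real.rpow_mul (by positivity),
      show -(1 / γ) * γ = -1 by field_simp, Real.rpow_neg_one, ← div_eq_mul_inv,
      div_le_one (by positivity)]
    linarith
  have hlogA : A / r = 4 * (1 + M) := by
    rw [hr_def]; field_simp
  have hlogR : Real.log (max A (1 + N) / max A δ)
      ≤ Real.log (1 + N) + 1 / γ * Real.log (1 + M) := by
    have hle : max A (1 + N) / max A δ ≤ (1 + N) / δ := by
      have hδ' : 0 < max A δ := lt_max_of_lt_right hδ
      rw [div_le_div_iff₀ hδ' hδ]
      rcases le_total A (1 + N) with h | h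
      · rw [max_eq_right h]
        gcongr
        exact le_max_right _ _
      · rw [max_eq_left h, mul_comm]
        have : δ ≤ 1 + N := by linarith
        gcongr
        exact le_max_left _ _
    refine (Real.log_le_log ?_ hle).trans_eq ?_
    · have : 0 < max A (1 + N) := lt_max_of_lt_left hA
      have : 0 < max A δ := lt_max_of_lt_left hA
      positivity
    · rw [Real.log_div (by positivity) hδ.ne', hδ_def, Real.log_rpow (by positivity)]
      ring
  -- The denominator dominates both A and N, whence 2 + 4 = 6.
  have hB : (2 * A + 4 * N) / max A (1 + N) ≤ 6 := by
    rw [div_le_iff₀ (lt_max_of_lt_left hA)]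
    linarith [le_max_left A (1 + N), le_max_right A (1 + N)]
  have hlog4 : 0 ≤ Real.log (4 * (1 + M)) := Real.log_nonneg (by linarith)
  have hlogM : 0 ≤ Real.log (1 + M) := Real.log_nonneg (by linarith)
  have hlogN : 0 ≤ Real.log (1 + N) := Real.log_nonneg (by linarith)
  refine (lintegral_mono_set hcover).trans ?_
  refine (lintegral_union_le _ _ _).trans ?_
  rw [ENNReal.ofReal_add (by positivity) (by positivity)]
  refine add_le_add ?_ ((lintegral_outer_le hs (lt_max_of_lt_left hA) h2 r).trans
    (ENNReal.ofReal_le_ofReal (by nlinarith)))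
  refine (lintegral_union_le _ _ _).trans ?_
  rw [ENNReal.ofReal_add (by positivity) (by positivity)]
  refine add_le_add ?_ ((lintegral_annulus_le hr (lt_max_of_lt_left hA) hδR s).trans
    (ENNReal.ofReal_le_ofReal (by gcongr)))
  refine (lintegral_union_le _ _ _).trans ?_
  rw [ENNReal.ofReal_add (by positivity) (by positivity)]
  refine add_le_add ?_ ((lintegral_inner_le hs hA hM hγ hδ.le h1 r).trans
    (ENNReal.ofReal_le_ofReal (by gcongr)))
  refine (lintegral_union_le _ _ _).trans ?_
  rw [ENNReal.ofReal_add (by positivity) (by positivity)]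
  exact add_le_add (lintegral_core_le hr s) ((lintegral_annulus_le hr hr hrA s).trans_eq
    (by rw [hlogA]))

/-! ### Principal values for one interface -/

/-- The hypothesis says that the ball of radius r misses the graph, so z and -z lie on the same side
of it. -/
lemma asym_eq_of_norm_le {s : R2 → ℝ} {r : ℝ} (h0 : s 0 ≠ 0)
    (hr : ∀ w, ‖w‖ ≤ r → |s w - s 0| < |s 0| - r) (z : R3) (hz : ‖z‖ ≤ r) :
    asym s z = if 0 < s 0 then -1 else 1 := by
  have hside (y : R3) (hy : ‖y‖ ≤ r) : side s y = if 0 < s 0 then 0 else 1 := by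
    have h1 := abs_lt.1 (hr (horiz y) ((norm_horiz_le y).trans hy))
    have h2 := abs_le.1 ((abs_vert_le y).trans hy)
    unfold side
    rcases lt_or_gt_of_ne h0 with h | h
    · rw [abs_of_neg h] at h1
      rw [if_pos (by linarith), if_neg h.not_gt]
    · rw [abs_of_pos h] at h1
      rw [if_neg (by linarith), if_pos h]
  rw [asym, hside z hz, hside (-z) (by rwa [norm_neg])]
  split_ifs <;> norm_num

lemma asym_eq_zero_of_lt {s : R2 → ℝ} {B : ℝ} (hB : ∀ w, |s w| ≤ B) (z : R3) (hz : B < |z 2|) :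
    asym s z = 0 := by
  refine asym_eq_zero fun h => hz.not_ge ?_
  have h1 := abs_le.1 (hB (horiz z))
  have h2 := abs_le.1 (hB (-horiz z))
  rw [Set.mem_uIcc] at h
  rw [abs_le]
  rcases h with h | h <;> constructor <;> linarith [h.1, h.2]

/-- The right-hand side of the logarithmic estimate. -/
def logBound (γ M N : ℝ) : ℝ :=
  1 + 1 / γ + 1 / γ * Real.log (1 + M) + Real.log (1 + N)

/-- Only π ≤ 4 and log 4 ≤ 3 are used. The constant terms then add up to 288, and 1 ≤ 1/γ absorbs
the bare log(1 + M). -/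
lemma logBound_dominates {γ M N : ℝ} (hγ : 0 < γ) (hγ1 : γ ≤ 1) (hM : 0 ≤ M) (hN : 0 ≤ N) :
    2 * Real.pi ^ 2 + 4 * Real.pi ^ 2 * Real.log (4 * (1 + M))
        + (4 * Real.pi + 4 * Real.pi * (1 / γ))
        + 4 * Real.pi ^ 2 * (Real.log (1 + N) + 1 / γ * Real.log (1 + M))
        + 12 * Real.pi ≤ 300 * logBound γ M N := by
  have hpi := Real.pi_pos
  have hpi4 := Real.pi_le_four
  have hpi2 : Real.pi ^ 2 ≤ 16 := by nlinarith
  have hlogM : 0 ≤ Real.log (1 + M) := Real.log_nonneg (by linarith)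
  have hlogN : 0 ≤ Real.log (1 + N) := Real.log_nonneg (by linarith)
  have hγ' : 1 ≤ 1 / γ := by rw [le_div_iff₀ hγ]; linarith
  have hlog4 : Real.log 4 ≤ 3 := by
    have := Real.log_le_sub_one_of_pos (x := 4) (by norm_num)
    linarith
  have hL : Real.log (1 + M) ≤ 1 / γ * Real.log (1 + M) := le_mul_of_one_le_left hlogM hγ'
  rw [Real.log_mul (by norm_num) (by positivity), logBound]
  set L := 1 / γ * Real.log (1 + M)
  have e1 : Real.pi ^ 2 * (Real.log 4 + Real.log (1 + M)) ≤ 16 * (3 + L) := by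
    gcongr
  have e2 : Real.pi ^ 2 * (Real.log (1 + N) + L) ≤ 16 * (Real.log (1 + N) + L) := by
    gcongr
  have e3 : Real.pi * (1 / γ) ≤ 4 * (1 / γ) := by gcongr
  nlinarith

/-- The principal value for the region above a graph: the truncated integrals are eventually
constant, and their value obeys a logarithmic estimate. -/
lemma exists_setIntegral_side_eq {s : R2 → ℝ} (hs : Continuous s) (h0 : s 0 ≠ 0) {B : ℝ}
    (hB : ∀ w, |s w| ≤ B) :
    ∃ V : R3, (∀ᶠ q : ℝ × ℝ in 𝓝[>] (0 : ℝ) ×ˢ atTop,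
        ∫ z in slab q.1 q.2, side s z • darcyKernel z = V) ∧
      ∀ γ M N : ℝ, 0 < γ → γ ≤ 1 → 0 ≤ M → 0 ≤ N → (∀ w, |s w - s 0| ≤ M * ‖w‖) →
        (∀ w, |s w + s (-w) - 2 * s 0| ≤ 2 * M * ‖w‖ ^ (1 + γ)) →
        (∀ w, |s w - s 0| ≤ 2 * N) →
        ‖V‖ ≤ ‖∫ z in slab 1 2, darcyKernel z‖ + 300 * logBound γ M N := by
  have hA : 0 < |s 0| := abs_pos.2 h0
  have hval {r ε H : ℝ} (hr : ∀ w, ‖w‖ ≤ r → |s w - s 0| < |s 0| - r) (hε : 0 < ε) (hεr : ε ≤ r)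
      (hH : max r B + 1 ≤ H) : ∫ z in slab ε H, side s z • darcyKernel z
        = (1 / 2 : ℝ) • ((∫ z in slab 1 2, darcyKernel z)
          + ∫ z in slab r (max r B + 1), asym s z • darcyKernel z) := by
    have hrB : r < max r B + 1 := by linarith [le_max_left r B]
    rw [setIntegral_side_smul hs hε, setIntegral_slab hε (by linarith),
      setIntegral_asym_smul hs hε hεr hrB hH (asym_eq_of_norm_le h0 hr)
        fun z hz => asym_eq_zero_of_lt hB z (by linarith [le_max_right r B])]
  -- Continuity alone supplies a ball that misses the graph, so the limit exists even when no global
  -- gradient bound is available.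
  obtain ⟨r, hr0, hr⟩ : ∃ r > 0, ∀ w, ‖w‖ ≤ r → |s w - s 0| < |s 0| - r := by
    obtain ⟨η, hη, h⟩ := Metric.continuous_iff.1 hs 0 (|s 0| / 2) (by positivity)
    refine ⟨min (η / 2) (|s 0| / 2), by positivity, fun w hw => ?_⟩
    have h1 := h w (by
      rw [dist_zero_right]
      linarith [min_le_left (η / 2) (|s 0| / 2)])
    rw [Real.dist_eq] at h1
    linarith [min_le_right (η / 2) (|s 0| / 2)]
  refine ⟨(1 / 2 : ℝ) • ((∫ z in slab 1 2, darcyKernel z)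
      + ∫ z in slab r (max r B + 1), asym s z • darcyKernel z), ?_, ?_⟩
  · have h1 : ∀ᶠ ε in 𝓝[>] (0 : ℝ), 0 < ε ∧ ε ≤ r :=
      (eventually_mem_nhdsWithin).and (eventually_nhdsWithin_of_eventually_nhds
        ((eventually_lt_nhds hr0).mono fun _ h => h.le))
    filter_upwards [h1.prod_mk (eventually_ge_atTop (max r B + 1))] with q hq
    exact hval hr hq.1.1 hq.1.2 hq.2
  · intro γ M N hγ hγ1 hM hN hLip hHol hN'
    set ρ := |s 0| / (4 * (1 + M)) with hρ_def
    have hρ : 0 < ρ := by positivity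
    have hρA : ρ ≤ |s 0| / 4 := by
      rw [hρ_def]
      gcongr
      linarith
    have hMρ : M * ρ ≤ |s 0| / 4 := by
      rw [hρ_def, mul_div_assoc', div_le_div_iff₀ (by positivity) (by norm_num)]
      nlinarith
    have hρ' : ∀ w, ‖w‖ ≤ ρ → |s w - s 0| < |s 0| - ρ := fun w hw => by
      have : M * ‖w‖ ≤ M * ρ := by gcongr
      linarith [hLip w]
    -- The quantitative radius ρ gives the same value as r, since both expressions equal one
    -- truncated integral with small ε and large H.
    have heq := (hval hr (lt_min hr0 hρ) (min_le_left r ρ)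
      (le_max_left (max r B + 1) (max ρ B + 1))).symm.trans
      (hval hρ' (lt_min hr0 hρ) (min_le_right r ρ) (le_max_right _ _))
    rw [heq]
    have hsym (w : R2) : |s w + s (-w)| ≤ |s w + s (-w) - 2 * s 0| + 2 * |s 0| := by
      have := abs_add_le (s w + s (-w) - 2 * s 0) (2 * s 0)
      rwa [sub_add_cancel, abs_mul, abs_two] at this
    have hbd : ‖∫ z in slab ρ (max ρ B + 1), asym s z • darcyKernel z‖
        ≤ 300 * logBound γ M N := by
      refine le_trans ?_ (logBound_dominates hγ hγ1 hM hN)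
      have hlint := lintegral_asym_le hs hγ hM hN h0
        (fun w => by linarith [hsym w, hHol w])
        (fun w => by
          have h3 : |s w + s (-w) - 2 * s 0| ≤ |s w - s 0| + |s (-w) - s 0| := by
            rw [show s w + s (-w) - 2 * s 0 = (s w - s 0) + (s (-w) - s 0) by ring]
            exact abs_add_le _ _
          linarith [hsym w, hN' w, hN' (-w)])
      have hnn : 0 ≤ 2 * Real.pi ^ 2 + 4 * Real.pi ^ 2 * Real.log (4 * (1 + M))
          + (4 * Real.pi + 4 * Real.pi * (1 / γ))
          + 4 * Real.pi ^ 2 * (Real.log (1 + N) + 1 / γ * Real.log (1 + M))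
          + 12 * Real.pi := by
        have hlog4 : 0 ≤ Real.log (4 * (1 + M)) := Real.log_nonneg (by linarith)
        have hlogM : 0 ≤ Real.log (1 + M) := Real.log_nonneg (by linarith)
        have hlogN : 0 ≤ Real.log (1 + N) := Real.log_nonneg (by linarith)
        have := Real.pi_pos
        positivity
      rw [← ENNReal.ofReal_le_ofReal_iff hnn, ofReal_norm]
      refine (enorm_integral_le_lintegral_enorm _).trans (le_trans ?_ hlint)
      exact lintegral_mono_set fun z hz => hz.1
    rw [norm_smul]
    have h3 := norm_add_le (∫ z in slab 1 2, darcyKernel z)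
      (∫ z in slab ρ (max ρ B + 1), asym s z • darcyKernel z)
    have h4 : ‖(1 / 2 : ℝ)‖ = 1 / 2 := by norm_num
    rw [h4]
    linarith [norm_nonneg ((∫ z in slab 1 2, darcyKernel z)
      + ∫ z in slab ρ (max ρ B + 1), asym s z • darcyKernel z)]

/-! ### Regularity of the interface -/

lemma norm_gradient (h : R2 → ℝ) (x : R2) : ‖gradient h x‖ = ‖fderiv ℝ h x‖ := by
  simp [gradient]

lemma norm_gradient_sub (h : R2 → ℝ) (x y : R2) :
    ‖gradient h x - gradient h y‖ = ‖fderiv ℝ h x - fderiv ℝ h y‖ := by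
  simp [gradient, ← map_sub]

lemma abs_sub_le_of_norm_gradient_le {h : R2 → ℝ} (hh : ContDiff ℝ 1 h) {M : ℝ}
    (hM : ∀ x, ‖gradient h x‖ ≤ M) (x y : R2) : |h x - h y| ≤ M * ‖x - y‖ := by
  rw [← Real.norm_eq_abs]
  refine convex_univ.norm_image_sub_le_of_norm_fderiv_le (𝕜 := ℝ) (fun z _ => ?_) (fun z _ => ?_)
    (Set.mem_univ y) (Set.mem_univ x)
  · exact (hh.differentiable one_ne_zero) z
  · rw [← norm_gradient]
    exact hM z

/-- Mean value inequality for v ↦ h(x - v) + h(x + v) on the ball of radius ‖w‖: its derivative is a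
difference of gradients at distance 2‖v‖, and 2^γ ≤ 2. -/
lemma abs_second_difference_le {h : R2 → ℝ} (hh : ContDiff ℝ 1 h) {M γ : ℝ} (hγ : 0 < γ)
    (hγ1 : γ ≤ 1) (hM0 : 0 ≤ M)
    (hM : ∀ x y, ‖gradient h x - gradient h y‖ ≤ M * ‖x - y‖ ^ γ) (x w : R2) :
    |h (x - w) + h (x + w) - 2 * h x| ≤ 2 * M * ‖w‖ ^ (1 + γ) := by
  have hd := hh.differentiable one_ne_zero
  have hder (v : R2) : HasFDerivAt (fun v => h (x - v) + h (x + v))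
      (fderiv ℝ h (x + v) - fderiv ℝ h (x - v)) v := by
    have h1 : HasFDerivAt (fun v => h (x - v)) (-fderiv ℝ h (x - v)) v := by
      have := (hd (x - v)).hasFDerivAt.comp v ((hasFDerivAt_id v).const_sub x)
      simpa [Function.comp_def] using this
    have h2 : HasFDerivAt (fun v => h (x + v)) (fderiv ℝ h (x + v)) v := by
      have := (hd (x + v)).hasFDerivAt.comp v ((hasFDerivAt_id v).const_add x)
      simpa [Function.comp_def] using this
    have := h1.add h2
    rwa [neg_add_eq_sub] at this
  have hbound : ∀ v ∈ Metric.closedBall (0 : R2) ‖w‖,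
      ‖fderiv ℝ h (x + v) - fderiv ℝ h (x - v)‖ ≤ M * (2 * ‖w‖ ^ γ) := by
    intro v hv
    rw [mem_closedBall_zero_iff] at hv
    rw [← norm_gradient_sub]
    refine (hM _ _).trans ?_
    rw [show x + v - (x - v) = (2 : ℝ) • v by rw [two_smul]; abel, norm_smul, Real.norm_two,
      Real.mul_rpow (by norm_num) (norm_nonneg v)]
    have : (2 : ℝ) ^ γ ≤ 2 := by
      simpa using Real.rpow_le_rpow_of_exponent_le (x := 2) (by norm_num) hγ1
    gcongr
  have := (convex_closedBall (0 : R2) ‖w‖).norm_image_sub_le_of_norm_hasFDerivWithin_le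
    (fun v _ => (hder v).hasFDerivWithinAt) hbound
    (Metric.mem_closedBall_self (norm_nonneg w)) (by simp : w ∈ Metric.closedBall (0 : R2) ‖w‖)
  simp only [sub_zero, add_zero, Real.norm_eq_abs] at this
  rw [← two_mul] at this
  refine this.trans_eq ?_
  rcases eq_or_ne w 0 with rfl | hw
  · simp [Real.zero_rpow (by positivity : 1 + γ ≠ 0)]
  · rw [Real.rpow_add (norm_pos_iff.2 hw), Real.rpow_one]
    ring

lemma exists_bound_of_tendsto {h : R2 → ℝ} (hh : Continuous h) {c : ℝ}
    (hc : Tendsto h (cocompact R2) (𝓝 c)) : ∃ B, ∀ x, |h x| ≤ B := by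
  have h1 : ∀ᶠ x in cocompact R2, |h x| < |c| + 1 :=
    hc.abs.eventually_lt_const (by linarith)
  obtain ⟨K, hK, hsub⟩ := mem_cocompact.1 h1
  obtain ⟨B, hB⟩ := hK.exists_bound_of_continuousOn hh.continuousOn
  refine ⟨max B (|c| + 1), fun x => ?_⟩
  by_cases hx : x ∈ K
  · exact (hB x hx).trans (le_max_left _ _)
  · exact (le_of_lt (hsub hx)).trans (le_max_right _ _)

/-- An almost everywhere bound on a continuous function holds everywhere, because a set of full
measure is dense. -/
lemma exists_sup_bound {h : R2 → ℝ} (hh : Continuous h) {B : ℝ} (hB : ∀ x, |h x| ≤ B) :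
    ∃ N : ℝ, 0 ≤ N ∧ ENNReal.ofReal N = eLpNorm h ∞ volume ∧ ∀ x, |h x| ≤ N := by
  have hfin : eLpNorm h ∞ volume ≠ ⊤ := by
    rw [eLpNorm_exponent_top]
    exact (eLpNormEssSup_lt_top_of_ae_bound (.of_forall hB)).ne
  refine ⟨(eLpNorm h ∞ volume).toReal, ENNReal.toReal_nonneg, ENNReal.ofReal_toReal hfin, ?_⟩
  have hae : ∀ᵐ x : R2, |h x| ≤ (eLpNorm h ∞ volume).toReal := by
    filter_upwards [enorm_ae_le_eLpNormEssSup h volume] with x hx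
    rw [← eLpNorm_exponent_top] at hx
    have := ENNReal.toReal_mono hfin hx
    simpa using this
  have hd := Measure.dense_of_ae hae
  have hcl : IsClosed {x | |h x| ≤ (eLpNorm h ∞ volume).toReal} :=
    isClosed_le hh.abs continuous_const
  intro x
  have : x ∈ closure {x | |h x| ≤ (eLpNorm h ∞ volume).toReal} := hd x
  rwa [hcl.closure_eq] at this

lemma norm_le_of_cGammaNorm {γ : ℝ≥0} {F : R2 → R2} (hF : cGammaNorm γ F ≠ ⊤) (x : R2) :
    ‖F x‖ ≤ (cGammaNorm γ F).toReal := by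
  have h : ‖F x‖ₑ ≤ cGammaNorm γ F := (le_iSup (fun x => ‖F x‖ₑ) x).trans le_self_add
  simpa using ENNReal.toReal_mono hF h

lemma norm_sub_le_of_cGammaNorm {γ : ℝ≥0} {F : R2 → R2} (hF : cGammaNorm γ F ≠ ⊤) (x y : R2) :
    ‖F x - F y‖ ≤ (cGammaNorm γ F).toReal * ‖x - y‖ ^ (γ : ℝ) := by
  have hle : eHolderNorm γ F ≤ cGammaNorm γ F := le_add_self
  have hmem : MemHolder γ F := eHolderNorm_ne_top.1 (ne_top_of_le_ne_top hF hle)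
  have h1 := hmem.holderWith.dist_le x y
  rw [dist_eq_norm, dist_eq_norm] at h1
  refine h1.trans ?_
  gcongr
  exact ENNReal.toReal_mono hF hle

/-! ### The velocity of the three-phase density -/

/-- The height of `x` above the graph of `h`, along the horizontal plane. -/
def height (h : R2 → ℝ) (x : R3) (w : R2) : ℝ := x 2 - h (horiz x - w)

lemma continuous_height {h : R2 → ℝ} (hh : Continuous h) (x : R3) : Continuous (height h x) := by
  unfold height; fun_prop

/-- The non-strict inequality in `side` is the negation of the strict one in `density`, so the
identity holds at every point; g < f makes the two jumps nested. -/
lemma density_sub {ρ₁ ρ₂ ρ₃ : ℝ} {f g : R2 → ℝ} (hfg : ∀ x, g x < f x) (x z : R3) :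
    density ρ₁ ρ₂ ρ₃ f g (x - z)
      = ρ₁ + (ρ₂ - ρ₁) * side (height f x) z + (ρ₃ - ρ₂) * side (height g x) z := by
  have hlt := hfg (horiz x - horiz z)
  have hiff (a : ℝ) : x 2 - a ≤ z 2 ↔ ¬ a < x 2 - z 2 := by
    rw [not_lt, sub_le_comm]
  simp only [density, side, height, horiz_sub, PiLp.sub_apply, hiff]
  by_cases h1 : f (horiz x - horiz z) < x 2 - z 2
  · simp [h1, hlt.trans h1]
  · by_cases h2 : g (horiz x - horiz z) < x 2 - z 2 <;> simp [h1, h2]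

lemma abs_density_le (ρ₁ ρ₂ ρ₃ : ℝ) (f g : R2 → ℝ) (x : R3) :
    |density ρ₁ ρ₂ ρ₃ f g x| ≤ |ρ₁| + |ρ₂| + |ρ₃| := by
  have := abs_nonneg ρ₁
  have := abs_nonneg ρ₂
  have := abs_nonneg ρ₃
  unfold density
  split_ifs <;> linarith

lemma norm_e3 : ‖e3‖ = 1 := by
  simp [e3, EuclideanSpace.norm_eq, Fin.sum_univ_three]

lemma darcyTrunc_density {ρ₁ ρ₂ ρ₃ : ℝ} {f g : R2 → ℝ} (hf : Continuous f) (hg : Continuous g)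
    (hfg : ∀ x, g x < f x) (x : R3) {ε : ℝ} (hε : 0 < ε) (H : ℝ) :
    darcyTrunc (density ρ₁ ρ₂ ρ₃ f g) x ε H
      = ρ₁ • (∫ z in slab ε H, darcyKernel z)
        + (ρ₂ - ρ₁) • (∫ z in slab ε H, side (height f x) z • darcyKernel z)
        + (ρ₃ - ρ₂) • (∫ z in slab ε H, side (height g x) z • darcyKernel z)
        - ((2 / 3) * density ρ₁ ρ₂ ρ₃ f g x) • e3 := by
  have hi := integrableOn_slab hε H
  have hside {h : R2 → ℝ} (hh : Continuous h) :
      IntegrableOn (fun z => side (height h x) z • darcyKernel z) (slab ε H) :=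
    integrableOn_smul_darcyKernel (measurable_side (continuous_height hh x)) (abs_side_le _) hi
  have i1 : IntegrableOn (fun z => ρ₁ • darcyKernel z) (slab ε H) := hi.smul ρ₁
  have i2 : IntegrableOn (fun z => (ρ₂ - ρ₁) • side (height f x) z • darcyKernel z) (slab ε H) :=
    (hside hf).smul (ρ₂ - ρ₁)
  have i3 : IntegrableOn (fun z => (ρ₃ - ρ₂) • side (height g x) z • darcyKernel z) (slab ε H) :=
    (hside hg).smul (ρ₃ - ρ₂)
  have i12 : IntegrableOn (fun z => ρ₁ • darcyKernel z
      + (ρ₂ - ρ₁) • side (height f x) z • darcyKernel z) (slab ε H) := i1.add i2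
  have hset : {y : R3 | ε < ‖x - y‖ ∧ |x 2 - y 2| < H} = (fun y => x - y) ⁻¹' slab ε H := rfl
  have hmeas : MeasurableSet ((fun y => x - y) ⁻¹' slab ε H) :=
    (measurable_const.sub measurable_id) (measurableSet_slab ε H)
  have hcv : ∫ y in {y : R3 | ε < ‖x - y‖ ∧ |x 2 - y 2| < H},
        density ρ₁ ρ₂ ρ₃ f g y • darcyKernel (x - y)
      = ∫ z in slab ε H, density ρ₁ ρ₂ ρ₃ f g (x - z) • darcyKernel z := by
    rw [hset, ← integral_indicator hmeas, ← integral_indicator (measurableSet_slab ε H),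
      
      ← integral_sub_left_eq_self ((slab ε H).indicator _) volume x]
    congr 1
    ext1 y
    by_cases hy : x - y ∈ slab ε H
    · have hy' : y ∈ (fun y => x - y) ⁻¹' slab ε H := hy
      rw [Set.indicator_of_mem hy, Set.indicator_of_mem hy', sub_sub_cancel]
    · have hy' : y ∉ (fun y => x - y) ⁻¹' slab ε H := hy
      rw [Set.indicator_of_notMem hy, Set.indicator_of_notMem hy']
  rw [darcyTrunc, hcv, ← integral_smul, ← integral_smul, ← integral_smul, ← integral_add i1 i2,
    ← integral_add i12 i3]
  simp only [density_sub hfg, add_smul, mul_smul]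

/-- The data of one interface that enter the velocity estimate. -/
structure InterfaceBound (h : R2 → ℝ) (γ M N : ℝ) : Prop where
  lipschitz : ∀ x y, |h x - h y| ≤ M * ‖x - y‖
  second_difference : ∀ x w, |h (x - w) + h (x + w) - 2 * h x| ≤ 2 * M * ‖w‖ ^ (1 + γ)
  oscillation : ∀ x y, |h x - h y| ≤ 2 * N

/-- The limit V is fixed before γ, M and N, so convergence does not depend on the norms being
finite. The jumps ρ₂ - ρ₁ and ρ₃ - ρ₂ are positive and add up to ρ₃ - ρ₁. -/
lemma exists_velocity {ρ₁ ρ₂ ρ₃ : ℝ} (h₁₂ : ρ₁ < ρ₂) (h₂₃ : ρ₂ < ρ₃) {f g : R2 → ℝ}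
    (hf : Continuous f) (hg : Continuous g) (hfg : ∀ x, g x < f x) {B : ℝ}
    (hfB : ∀ x, |f x| ≤ B) (hgB : ∀ x, |g x| ≤ B) (x : R3) (hxf : x 2 ≠ f (horiz x))
    (hxg : x 2 ≠ g (horiz x)) :
    ∃ V : R3, Tendsto (fun q : ℝ × ℝ => darcyTrunc (density ρ₁ ρ₂ ρ₃ f g) x q.1 q.2)
        (𝓝[>] (0 : ℝ) ×ˢ atTop) (𝓝 V) ∧
      ∀ γ M N : ℝ, 0 < γ → γ ≤ 1 → 0 ≤ M → 0 ≤ N → InterfaceBound f γ M N →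
        InterfaceBound g γ M N →
        ‖V‖ ≤ (|ρ₁| + (ρ₃ - ρ₁)) * ‖∫ z in slab 1 2, darcyKernel z‖
          + (|ρ₁| + |ρ₂| + |ρ₃|) + (ρ₃ - ρ₁) * (300 * logBound γ M N) := by
  have key (h : R2 → ℝ) (hh : Continuous h) (hB : ∀ x, |h x| ≤ B) (hx : x 2 ≠ h (horiz x)) :
      ∃ V : R3, (∀ᶠ q : ℝ × ℝ in 𝓝[>] (0 : ℝ) ×ˢ atTop,
          ∫ z in slab q.1 q.2, side (height h x) z • darcyKernel z = V) ∧
        ∀ γ M N : ℝ, 0 < γ → γ ≤ 1 → 0 ≤ M → 0 ≤ N → InterfaceBound h γ M N →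
          ‖V‖ ≤ ‖∫ z in slab 1 2, darcyKernel z‖ + 300 * logBound γ M N := by
    obtain ⟨V, hV, hbound⟩ := exists_setIntegral_side_eq (continuous_height hh x)
      (by simpa [height, sub_eq_zero] using hx) (B := |x 2| + B)
      (fun w => (abs_sub _ _).trans (by linarith [hB (horiz x - w)]))
    refine ⟨V, hV, fun γ M N hγ hγ1 hM hN hb => hbound γ M N hγ hγ1 hM hN
      (fun w => ?_) (fun w => ?_) (fun w => ?_)⟩
    · have := hb.lipschitz (horiz x) (horiz x - w)
      simpa [height] using this
    · have := hb.second_difference (horiz x) w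
      rw [← abs_neg] at this
      convert this using 2
      simp only [height, sub_zero, sub_neg_eq_add]
      ring
    · have := hb.oscillation (horiz x) (horiz x - w)
      simpa [height] using this
  obtain ⟨Vf, hVf, hbf⟩ := key f hf hfB hxf
  obtain ⟨Vg, hVg, hbg⟩ := key g hg hgB hxg
  refine ⟨ρ₁ • (∫ z in slab 1 2, darcyKernel z) + (ρ₂ - ρ₁) • Vf + (ρ₃ - ρ₂) • Vg
    - ((2 / 3) * density ρ₁ ρ₂ ρ₃ f g x) • e3, ?_, ?_⟩
  · refine tendsto_const_nhds.congr' ?_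
    have h1 : ∀ᶠ ε in 𝓝[>] (0 : ℝ), 0 < ε ∧ ε < 1 :=
      (eventually_mem_nhdsWithin).and (eventually_nhdsWithin_of_eventually_nhds
        (eventually_lt_nhds one_pos))
    filter_upwards [hVf, hVg, h1.prod_mk (eventually_ge_atTop (1 : ℝ))] with q h2 h3 h4
    rw [darcyTrunc_density hf hg hfg x h4.1.1, h2, h3,
      setIntegral_slab h4.1.1 (h4.1.2.trans_le h4.2)]
  · intro γ M N hγ hγ1 hM hN hbf' hbg'
    have e1 := hbf γ M N hγ hγ1 hM hN hbf'
    have e2 := hbg γ M N hγ hγ1 hM hN hbg'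
    set c := ‖∫ z in slab 1 2, darcyKernel z‖
    have a1 : 0 < ρ₂ - ρ₁ := by linarith
    have a2 : 0 < ρ₃ - ρ₂ := by linarith
    have e3' : ‖((2 / 3) * density ρ₁ ρ₂ ρ₃ f g x) • e3‖ ≤ |ρ₁| + |ρ₂| + |ρ₃| := by
      rw [norm_smul, norm_e3, mul_one, norm_mul, Real.norm_eq_abs (density _ _ _ _ _ _)]
      have := abs_density_le ρ₁ ρ₂ ρ₃ f g x
      have h23 : ‖(2 / 3 : ℝ)‖ = 2 / 3 := by norm_num
      rw [h23]
      linarith [abs_nonneg (density ρ₁ ρ₂ ρ₃ f g x)]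
    calc _ ≤ ‖ρ₁ • (∫ z in slab 1 2, darcyKernel z)‖ + ‖(ρ₂ - ρ₁) • Vf‖ + ‖(ρ₃ - ρ₂) • Vg‖
          + ‖((2 / 3) * density ρ₁ ρ₂ ρ₃ f g x) • e3‖ :=
          (norm_sub_le _ _).trans (by gcongr; exact norm_add₃_le)
      _ ≤ |ρ₁| * c + (ρ₂ - ρ₁) * (c + 300 * logBound γ M N)
          + (ρ₃ - ρ₂) * (c + 300 * logBound γ M N) + (|ρ₁| + |ρ₂| + |ρ₃|) := by
          rw [norm_smul, norm_smul, norm_smul, Real.norm_eq_abs, Real.norm_of_nonneg a1.le,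
            Real.norm_of_nonneg a2.le]
          gcongr
      _ = _ := by ring

/-- Only differences of h enter, so its limit c at infinity drops out and the oscillation is twice
the deviation from c. -/
lemma interfaceBound_of_cGammaNorm {h : R2 → ℝ} (hh : ContDiff ℝ 1 h) {γ : ℝ≥0} (hγ : 0 < γ)
    (hγ1 : γ < 1) {M N c : ℝ} (hfin : cGammaNorm γ (gradient h) ≠ ⊤)
    (hM : (cGammaNorm γ (gradient h)).toReal ≤ M) (hN : ∀ x, |h x - c| ≤ N) :
    InterfaceBound h γ M N where
  lipschitz := abs_sub_le_of_norm_gradient_le hh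
    fun x => (norm_le_of_cGammaNorm hfin x).trans hM
  second_difference := abs_second_difference_le hh (by exact_mod_cast hγ)
    (by exact_mod_cast hγ1.le) (ENNReal.toReal_nonneg.trans hM)
    fun x y => (norm_sub_le_of_cGammaNorm hfin x y).trans (by gcongr)
  oscillation x y := by
    have h1 := hN x
    have h2 := hN y
    rw [abs_le] at *
    constructor <;> linarith [h1.1, h1.2, h2.1, h2.2]

lemma logBound_le_coe {γ M N : ℝ} (hγ : 0 < γ) (hM : 0 ≤ M) (hN : 0 ≤ N)
    {X Y : ℝ≥0∞} (hX : ENNReal.ofReal (1 + M) ≤ X) (hY : ENNReal.ofReal (1 + N) ≤ Y) :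
    (logBound γ M N : EReal) ≤ 1 + ((1 / γ : ℝ) : EReal)
      + ((1 / γ : ℝ) : EReal) * ENNReal.log X + ENNReal.log Y := by
  have hX' := ENNReal.log_monotone hX
  have hY' := ENNReal.log_monotone hY
  rw [ENNReal.log_ofReal_of_pos (by linarith)] at hX' hY'
  have hγ' : (0 : EReal) ≤ ((1 / γ : ℝ) : EReal) := by
    exact_mod_cast (by positivity : (0 : ℝ) ≤ 1 / γ)
  rw [logBound, EReal.coe_add, EReal.coe_add, EReal.coe_add, EReal.coe_mul, EReal.coe_one]
  gcongr

end Muskat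

end

/-! ### The velocity estimate in extended real form. -/

theorem mainTheorem2 (ρ₁ ρ₂ ρ₃ : ℝ) (h₁₂ : ρ₁ < ρ₂) (h₂₃ : ρ₂ < ρ₃) :
    ∃ C : ℝ, 0 < C ∧
      ∀ (γ : ℝ≥0), 0 < γ → γ < 1 →
      ∀ (Cinf T : ℝ), 0 < T →
      ∀ (f g : ℝ → Muskat.R2 → ℝ), Muskat.IsContourSolution ρ₁ ρ₂ ρ₃ Cinf T f g →
      ∀ t ∈ Set.Icc 0 T,
        -- the principal value that defines the velocity converges off the two interfaces
        (∀ x : Muskat.R3, x 2 ≠ f t (Muskat.horiz x) → x 2 ≠ g t (Muskat.horiz x) →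
          Tendsto
            (fun q : ℝ × ℝ =>
              Muskat.darcyTrunc (Muskat.density ρ₁ ρ₂ ρ₃ (f t) (g t)) x q.1 q.2)
            (𝓝[>] (0 : ℝ) ×ˢ atTop)
            (𝓝 (Muskat.darcyVelocity (Muskat.density ρ₁ ρ₂ ρ₃ (f t) (g t)) x))) ∧
        -- and the velocity obeys the bound, in which the norms on the right may be infinite
        ((eLpNorm (Muskat.darcyVelocity (Muskat.density ρ₁ ρ₂ ρ₃ (f t) (g t))) ∞ volume : ℝ≥0∞)
            : EReal) ≤
          (C : EReal) *
            (1 + ((1 / (γ : ℝ) : ℝ) : EReal)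
              + ((1 / (γ : ℝ) : ℝ) : EReal) *
                  ENNReal.log (1 + Muskat.cGammaNorm γ (gradient (f t))
                    + Muskat.cGammaNorm γ (gradient (g t)))
              + ENNReal.log (1 + eLpNorm (fun x => f t x - Cinf) ∞ volume + ENNReal.ofReal Cinf
                    + eLpNorm (gradient (f t)) 2 volume
                    + eLpNorm (g t) ∞ volume + eLpNorm (gradient (g t)) 2 volume)) := by
  set c := ‖∫ z in Muskat.slab 1 2, Muskat.darcyKernel z‖
  -- D collects the terms free of logarithms: the fixed integral of the kernel and the local term.
  -- It is absorbed below because L ≥ 1.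
  set D := (|ρ₁| + (ρ₃ - ρ₁)) * c + (|ρ₁| + |ρ₂| + |ρ₃|) with hD_def
  have hD : 0 ≤ D := by
    have : 0 ≤ ρ₃ - ρ₁ := by linarith
    positivity
  have hC : 0 < D + (ρ₃ - ρ₁) * 300 := by nlinarith
  refine ⟨D + (ρ₃ - ρ₁) * 300, hC, ?_⟩
  intro γ hγ hγ1 Cinf T _ f g hsol t ht
  have hγ' : (0 : ℝ) < γ := by exact_mod_cast hγ
  have hγ1' : (γ : ℝ) ≤ 1 := by exact_mod_cast hγ1.le
  have hf := hsol.contDiff_f t ht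
  have hg := hsol.contDiff_g t ht
  have hfg := hsol.lt t ht
  obtain ⟨Bf, hBf⟩ := Muskat.exists_bound_of_tendsto hf.continuous (hsol.tendsto_f t ht)
  obtain ⟨Bg, hBg⟩ := Muskat.exists_bound_of_tendsto hg.continuous (hsol.tendsto_g t ht)
  have hvel (x : Muskat.R3) (hxf : x 2 ≠ f t (Muskat.horiz x))
      (hxg : x 2 ≠ g t (Muskat.horiz x)) :=
    Muskat.exists_velocity h₁₂ h₂₃ hf.continuous hg.continuous hfg
      (fun y => (hBf y).trans (le_max_left Bf Bg)) (fun y => (hBg y).trans (le_max_right Bf Bg))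
      x hxf hxg
  refine ⟨fun x hxf hxg => ?_, ?_⟩
  · obtain ⟨V, hV, -⟩ := hvel x hxf hxg
    -- `limUnder` is meaningful only once a limit is known to exist, which V provides.
    rwa [Muskat.darcyVelocity, hV.limUnder_eq]
  obtain ⟨Nf, hNf0, hNf, hNf'⟩ := Muskat.exists_sup_bound
    (h := fun x => f t x - Cinf) (by fun_prop) (B := Bf + |Cinf|)
    (fun x => (abs_sub _ _).trans (by linarith [hBf x]))
  obtain ⟨Ng, hNg0, hNg, hNg'⟩ := Muskat.exists_sup_bound hg.continuous hBg
  set X := 1 + Muskat.cGammaNorm γ (gradient (f t)) + Muskat.cGammaNorm γ (gradient (g t)) with hX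
  set Y := 1 + eLpNorm (fun x => f t x - Cinf) ∞ volume + ENNReal.ofReal Cinf
    + eLpNorm (gradient (f t)) 2 volume + eLpNorm (g t) ∞ volume
    + eLpNorm (gradient (g t)) 2 volume with hY
  have hYN : ENNReal.ofReal (1 + (Nf + Ng)) ≤ Y := by
    rw [ENNReal.ofReal_add one_pos.le (by positivity), ENNReal.ofReal_add hNf0 hNg0, hNf, hNg,
      ENNReal.ofReal_one, hY, ← add_assoc]
    refine le_trans ?_ le_self_add
    exact add_le_add_left (le_self_add.trans le_self_add) _
  by_cases hXtop : X = ⊤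
  -- In `EReal` the sum ⊤ + ⊥ is ⊥, so the right-hand side is infinite only because Y is positive.
  · have hYlog : ENNReal.log Y ≠ ⊥ := by
      rw [Ne, ENNReal.log_eq_bot_iff]
      exact (lt_of_lt_of_le (ENNReal.ofReal_pos.2 (by positivity)) hYN).ne'
    rw [hXtop, ENNReal.log_top, EReal.coe_mul_top_of_pos (by positivity),
      EReal.add_top_of_ne_bot (by
        rw [← EReal.coe_one, ← EReal.coe_add]
        exact EReal.coe_ne_bot _),
      EReal.top_add_of_ne_bot hYlog, EReal.coe_mul_top_of_pos hC]
    exact le_top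
  have hfin : Muskat.cGammaNorm γ (gradient (f t)) ≠ ⊤ ∧
      Muskat.cGammaNorm γ (gradient (g t)) ≠ ⊤ := by
    rw [hX] at hXtop
    simp only [ENNReal.add_eq_top, not_or] at hXtop
    exact ⟨hXtop.1.2, hXtop.2⟩
  set Mf := (Muskat.cGammaNorm γ (gradient (f t))).toReal with hMf
  set Mg := (Muskat.cGammaNorm γ (gradient (g t))).toReal with hMg
  have hMf0 : 0 ≤ Mf := ENNReal.toReal_nonneg
  have hMg0 : 0 ≤ Mg := ENNReal.toReal_nonneg
  have hXM : ENNReal.ofReal (1 + (Mf + Mg)) ≤ X := by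
    rw [ENNReal.ofReal_add one_pos.le (by positivity), ENNReal.ofReal_add hMf0 hMg0,
      hMf, hMg, ENNReal.ofReal_toReal hfin.1, ENNReal.ofReal_toReal hfin.2, ENNReal.ofReal_one,
      hX, add_assoc]
  have hbf := Muskat.interfaceBound_of_cGammaNorm hf hγ hγ1 (M := Mf + Mg) (N := Nf + Ng)
    (c := Cinf) hfin.1 (by linarith) (fun x => (hNf' x).trans (by linarith))
  have hbg := Muskat.interfaceBound_of_cGammaNorm hg hγ hγ1 (M := Mf + Mg) (N := Nf + Ng)
    (c := 0) hfin.2 (by linarith) (fun x => by rw [sub_zero]; linarith [hNg' x])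
  set L := Muskat.logBound γ (Mf + Mg) (Nf + Ng) with hL
  have hL1 : 1 ≤ L := by
    have h1 : 0 ≤ Real.log (1 + (Mf + Mg)) := Real.log_nonneg (by linarith)
    have h2 : 0 ≤ Real.log (1 + (Nf + Ng)) := Real.log_nonneg (by linarith)
    have h3 : (0 : ℝ) ≤ 1 / γ := by positivity
    rw [hL, Muskat.logBound]
    nlinarith [mul_nonneg h3 h1]
  have hae : ∀ᵐ x : Muskat.R3,
      ‖Muskat.darcyVelocity (Muskat.density ρ₁ ρ₂ ρ₃ (f t) (g t)) x‖
        ≤ (D + (ρ₃ - ρ₁) * 300) * L := by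
    filter_upwards [Muskat.ae_vert_ne hf.continuous, Muskat.ae_vert_ne hg.continuous]
      with x hxf hxg
    obtain ⟨V, hV, hbound⟩ := hvel x hxf hxg
    rw [Muskat.darcyVelocity, hV.limUnder_eq]
    have := hbound γ (Mf + Mg) (Nf + Ng) hγ' hγ1' (by positivity) (by positivity) hbf hbg
    nlinarith
  have hle := eLpNormEssSup_le_of_ae_bound hae
  calc _ ≤ ((ENNReal.ofReal ((D + (ρ₃ - ρ₁) * 300) * L) : ℝ≥0∞) : EReal) := by
        rw [eLpNorm_exponent_top]
        exact_mod_cast hle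
    _ = ((D + (ρ₃ - ρ₁) * 300 : ℝ) : EReal) * (L : EReal) := by
        rw [EReal.coe_ennreal_ofReal, max_eq_left (by positivity), EReal.coe_mul]
    _ ≤ _ := by
        have hC' : (0 : EReal) ≤ ((D + (ρ₃ - ρ₁) * 300 : ℝ) : EReal) := by exact_mod_cast hC.le
        gcongr
        exact Muskat.logBound_le_coe hγ' (by positivity) (by positivity) hXM hYN
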